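/- **Setting.** A resonator is a triple $(v,\ell,s)$ of positive reals (wave speed, length, spacing to the right neighbour). Fix finitely many blocks $B_1,\dots,B_D$; each block is a finite nonempty sequence of resonators. A bi-infinite block sequence $\chi'\in\{1,\dots,D\}^{\mathbb Z}$ determines, by concatenating the blocks, a bi-infinite resonator sequence $(v_i,\ell_i,s_i)_{i\in\mathbb Z}$, where resonator $0$ is the first resonator of block $0$; likewise a semi-infinite $\chi_+\in\{1,\dots,D\}^{\mathbb Z_{\ge0}}$ determines $(v_i,\ell_i,s_i)_{i\ge0}$. Put $$a^{(i)}=-\frac{v_iv_{i+1}}{s_i\sqrt{\ell_i\ell_{i+1}}},\qquad b^{(i)}=\frac{v_i^2}{\ell_i}\Big(\frac1{s_{i-1}}+\frac1{s_i}\Big).$$ $J(\chi')$ is the Jacobi operator on $\ell^2(\mathbb Z)$, $(Jv)^{(i)}=a^{(i-1)}v^{(i-1)}+a^{(i)}v^{(i+1)}+b^{(i)}v^{(i)}$. $J_+(\chi_+)$ is the Jacobi operator on $\ell^2(\mathbb Z_{\ge0})$ given by the same formula for $i>0$, and by $(J_+v)^{(0)}=a^{(0)}v^{(1)}+\frac{v_0^2}{\ell_0s_0}v^{(0)}$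 for $i=0$. For $\lambda\in\mathbb R$ and a resonator $(v,\ell,s)$ let $$P^\lambda_{(v,\ell,s)}=\begin{pmatrix}1-s\frac{\ell}{v^2}\lambda& s\\-\frac{\ell}{v^2}\lambda&1\end{pmatrix}\in SL(2,\mathbb R).$$ The resonator cocycle of $\chi'$ is $P^\lambda(i)=P^\lambda_{(v_i,\ell_i,s_i)}$, with $P^\lambda_i(0)=P^\lambda(i-1)\cdots P^\lambda(0)$ for $i\ge0$. The block propagation cocycle is $\mathcal P^\lambda(j)=\mathcal P^\lambda_{\chi'(j)}$, where $\mathcal P^\lambda_d$ is the ordered product $P_{\mathrm{len}}\cdots P_2P_1$ of the matrices of the resonators of $B_d$ (leftmost resonator acting first). Further, let $$Q(i)=\begin{pmatrix}\frac{v_i}{\sqrt{\ell_i}}&0\\ \frac{v_i}{\sqrt{\ell_i}\,s_{i-1}}&-\frac{v_{i-1}}{\sqrt{\ell_{i-1}}\,s_{i-1}}\end{pmatrix}.$$ A bounded cocycle $P:\mathbb Z\to SL(2,\mathbb R)$, with iterates $P_n(i)=P(i+n-1)\cdots P(i)$ and $P_{-n}(i)=P(i-n)^{-1}\cdots P(i-1)^{-1}$,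 is uniformly hyperbolic if there are $s,u:\mathbb Z\to\mathbb{RP}^1$ with $P(i)s(i)=s(i+1)$ and $P(i)u(i)=u(i+1)$ for all $i$, and $C>0$, $\eta>1$ with $\|P_{-n}(i)\vec u\|,\|P_n(i)\vec s\|\le C\eta^{-n}$ for all $i\in\mathbb Z$, $n\in\mathbb N$ and all unit vectors $\vec u\in u(i)$, $\vec s\in s(i)$. The map $s$ is the stable direction. A sequence $\chi_+$ is pseudo-ergodic if it contains every finite word over $\{1,\dots,D\}$. **Theorem.** Let $\chi_+\in\{1,\dots,D\}^{\mathbb Z_{\ge0}}$ be pseudo-ergodic and let $\chi'\in\{1,\dots,D\}^{\mathbb Z}$ satisfy $\chi'^{(i)}=\chi_+^{(i)}$ for all $i\ge0$. Let $\lambda\in\mathbb R$. 1. If $\lambda\in\sigma(J_+(\chi_+))\setminus\sigma(J(\chi'))$, then the block propagation cocycle $\mathcal P^\lambda$ of $\chi'$ is uniformly hyperbolic and $(1,0)^\top\in s(0)$, where $s$ is its stable direction. Moreover, $\lambda$ is an eigenvalue of $J_+(\chi_+)$ of multiplicity one, with eigenvector $v\in\ell^2(\mathbb Z_{\ge0})$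 given by $$\begin{pmatrix}v^{(i)}\\v^{(i-1)}\end{pmatrix}=Q(i)^{-1}P^\lambda_i(0)\begin{pmatrix}1\\0\end{pmatrix},\qquad i\ge0,$$ where $Q$ and $P^\lambda$ are those of $\chi'$, and for $i=0$ only the first component is meant. 2. Conversely, if $\lambda\notin\sigma(J(\chi'))$, then $\mathcal P^\lambda$ is uniformly hyperbolic, and if its stable direction satisfies $(1,0)^\top\in s(0)$, then $\lambda\in\sigma(J_+(\chi_+))$ and $\lambda$ is an eigenvalue of $J_+(\chi_+)$ of multiplicity one with the eigenvector given above. -/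

import Mathlib

namespace BlockDisorder

/-! ### Resonators, blocks and resonator sequences -/

/-- A single resonator: wave speed, length, and spacing to the next resonator on its right. -/
structure Resonator where
  speed : ℝ
  length : ℝ
  spacing : ℝ
  speed_pos : 0 < speed
  length_pos : 0 < length
  spacing_pos : 0 < spacing

/-- A block: a finite nonempty sequence of resonators, numbered from left to right. -/
structure Block where
  len : ℕ
  len_pos : 0 < len
  res : Fin len → Resonator

/-- A sequence is pseudo-ergodic if it contains every finite word. -/
def PseudoErgodic {D : ℕ} (χ : ℕ → Fin D) : Prop :=
  ∀ (M : ℕ) (w : Fin M → Fin D), ∃ j : ℕ, ∀ k : Fin M, χ (j + k) = w k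

/-- `χ'` is a bi-infinite extension of `χp`. -/
def Extends {D : ℕ} (χp : ℕ → Fin D) (χ' : ℤ → Fin D) : Prop :=
  ∀ i : ℕ, χ' (i : ℤ) = χp i

/-- The alphabet of resonator labels `(d, r)`: the `r`-th resonator of the `d`-th block. -/
abbrev Label {D : ℕ} (B : Fin D → Block) : Type := Σ d : Fin D, Fin (B d).len

/-- The material parameters belonging to a label. -/
def Label.res {D : ℕ} {B : Fin D → Block} (p : Label B) : Resonator := (B p.1).res p.2

/-- A place in the array built from `χ`: the `r`-th resonator of the `j`-th sampled block. -/
abbrev Place {D : ℕ} (B : Fin D → Block) {ι : Type} (χ : ι → Fin D) : Type :=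
  Σ j : ι, Fin (B (χ j)).len

/-- The place immediately to the right. -/
def Place.next {D : ℕ} {B : Fin D → Block} {ι : Type} [Add ι] [One ι] {χ : ι → Fin D}
    (p : Place B χ) : Place B χ :=
  if h : (p.2 : ℕ) + 1 < (B (χ p.1)).len then ⟨p.1, ⟨(p.2 : ℕ) + 1, h⟩⟩
  else ⟨p.1 + 1, ⟨0, (B (χ (p.1 + 1))).len_pos⟩⟩

/-- The place immediately to the left (in a bi-infinite array). -/
def Place.prev {D : ℕ} {B : Fin D → Block} {χ : ℤ → Fin D} (p : Place B χ) : Place B χ :=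
  if (p.2 : ℕ) = 0 then
    ⟨p.1 - 1, ⟨(B (χ (p.1 - 1))).len - 1, Nat.sub_lt (B (χ (p.1 - 1))).len_pos Nat.one_pos⟩⟩
  else ⟨p.1, ⟨(p.2 : ℕ) - 1, lt_of_le_of_lt (Nat.sub_le _ _) p.2.isLt⟩⟩

/-- The place of the `i`-th resonator of a bi-infinite array; resonator `0` is the first resonator
of block `0`. -/
def placeAt {D : ℕ} (B : Fin D → Block) (χ : ℤ → Fin D) : ℤ → Place B χ
  | Int.ofNat n => Place.next^[n] ⟨0, ⟨0, (B (χ 0)).len_pos⟩⟩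
  | Int.negSucc n => Place.prev^[n + 1] ⟨0, ⟨0, (B (χ 0)).len_pos⟩⟩

/-- The place of the `i`-th resonator of a semi-infinite array. -/
def placeAtHalf {D : ℕ} (B : Fin D → Block) (χ : ℕ → Fin D) (n : ℕ) : Place B χ :=
  Place.next^[n] ⟨0, ⟨0, (B (χ 0)).len_pos⟩⟩

/-- The resonator sequence of a bi-infinite block sequence. -/
def labelSeq {D : ℕ} (B : Fin D → Block) (χ : ℤ → Fin D) (i : ℤ) : Label B :=
  ⟨χ (placeAt B χ i).1, (placeAt B χ i).2⟩

/-- The resonator sequence of a semi-infinite block sequence. -/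
def labelSeqHalf {D : ℕ} (B : Fin D → Block) (χ : ℕ → Fin D) (i : ℕ) : Label B :=
  ⟨χ (placeAtHalf B χ i).1, (placeAtHalf B χ i).2⟩

/-! ### Jacobi operators on `ℓ²` -/

/-- `ℓ²(ι)` with complex entries. -/
abbrev Ell2 (ι : Type) : Type := lp (fun _ : ι => ℂ) 2

theorem sum_weightedShift_le {ι : Type} (c : ι → ℝ) (f : ι → ι) {K : ℝ} (hK : 0 ≤ K)
    (hc : ∀ i, |c i| ≤ K) (hf : Set.InjOn f {i | c i ≠ 0}) (x : Ell2 ι) (s : Finset ι) :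
    ∑ i ∈ s, ‖(c i : ℂ) * x (f i)‖ ^ (2 : ENNReal).toReal
      ≤ (K * ‖x‖) ^ (2 : ENNReal).toReal := by
  classical
  have h2 : (0 : ℝ) < (2 : ENNReal).toReal := by norm_num
  have hinj : Set.InjOn f ((s.filter fun i => c i ≠ 0 : Finset ι) : Set ι) :=
    hf.mono fun i hi => by simp at hi; exact hi.2
  calc ∑ i ∈ s, ‖(c i : ℂ) * x (f i)‖ ^ (2 : ENNReal).toReal
      = ∑ i ∈ s with c i ≠ 0, ‖(c i : ℂ) * x (f i)‖ ^ (2 : ENNReal).toReal := by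
        refine (Finset.sum_filter_of_ne (p := fun i => c i ≠ 0) fun i _ h hi => h ?_).symm
        simp [hi]
    _ ≤ ∑ i ∈ s with c i ≠ 0, K ^ (2 : ENNReal).toReal * ‖x (f i)‖ ^ (2 : ENNReal).toReal := by
        refine Finset.sum_le_sum fun i _ => ?_
        rw [norm_mul, Real.mul_rpow (norm_nonneg _) (norm_nonneg _)]
        gcongr
        simpa using hc i
    _ = K ^ (2 : ENNReal).toReal *
          ∑ j ∈ (s.filter fun i => c i ≠ 0).image f, ‖x j‖ ^ (2 : ENNReal).toReal := by
        rw [Finset.sum_image hinj, Finset.mul_sum]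
    _ ≤ K ^ (2 : ENNReal).toReal * ‖x‖ ^ (2 : ENNReal).toReal := by
        gcongr
        exact lp.sum_rpow_le_norm_rpow h2 x _
    _ = (K * ‖x‖) ^ (2 : ENNReal).toReal := (Real.mul_rpow hK (norm_nonneg _)).symm

/-- The bounded operator `(W x)⁽ⁱ⁾ = c⁽ⁱ⁾ x⁽ᶠ⁽ⁱ⁾⁾` on `ℓ²(ι)`, for bounded real `c` and for `f`
injective where `c` does not vanish. -/
noncomputable def weightedShift {ι : Type} (c : ι → ℝ) (f : ι → ι) (hc : ∃ K, ∀ i, |c i| ≤ K)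
    (hf : Set.InjOn f {i | c i ≠ 0}) : Ell2 ι →L[ℂ] Ell2 ι :=
  have hK : ∀ i, |c i| ≤ max hc.choose 0 := fun i => (hc.choose_spec i).trans (le_max_left _ _)
  LinearMap.mkContinuous
    { toFun := fun x => ⟨fun i => (c i : ℂ) * x (f i),
        memℓp_gen' (sum_weightedShift_le c f (le_max_right _ _) hK hf x)⟩
      map_add' := fun x y => by ext i; exact mul_add _ _ _
      map_smul' := fun z x => by ext i; exact mul_left_comm _ _ _ }
    (max hc.choose 0)
    (fun x => lp.norm_le_of_forall_sum_le (by norm_num)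
      (mul_nonneg (le_max_right _ _) (norm_nonneg _))
      (sum_weightedShift_le c f (le_max_right _ _) hK hf x))

@[simp] theorem weightedShift_apply {ι : Type} (c : ι → ℝ) (f : ι → ι)
    (hc : ∃ K, ∀ i, |c i| ≤ K) (hf : Set.InjOn f {i | c i ≠ 0}) (x : Ell2 ι) (i : ι) :
    weightedShift c f hc hf x i = (c i : ℂ) * x (f i) := rfl

/-- The Jacobi operator on `ℓ²(ℤ)` with bounded real coefficients `a`, `b`. -/
noncomputable def jacobi (a b : ℤ → ℝ) (ha : ∃ K, ∀ i, |a i| ≤ K) (hb : ∃ K, ∀ i, |b i| ≤ K) :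
    Ell2 ℤ →L[ℂ] Ell2 ℤ :=
  weightedShift (fun i => a (i - 1)) (fun i => i - 1) (ha.imp fun _ h i => h (i - 1))
      (fun _ _ _ _ h => sub_left_injective h)
    + weightedShift a (fun i => i + 1) ha (fun _ _ _ _ h => add_left_injective 1 h)
    + weightedShift b id hb (Set.injOn_id _)

theorem jacobi_apply (a b : ℤ → ℝ) (ha : ∃ K, ∀ i, |a i| ≤ K) (hb : ∃ K, ∀ i, |b i| ≤ K)
    (x : Ell2 ℤ) (i : ℤ) :
    jacobi a b ha hb x i = a (i - 1) * x (i - 1) + a i * x (i + 1) + b i * x i := rfl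

/-- The coefficient sequence `0, a 0, a 1, …`. -/
def delay (a : ℕ → ℝ) : ℕ → ℝ
  | 0 => 0
  | n + 1 => a n

theorem delay_bounded {a : ℕ → ℝ} (ha : ∃ K, ∀ i, |a i| ≤ K) : ∃ K, ∀ i, |delay a i| ≤ K := by
  obtain ⟨K, hK⟩ := ha
  refine ⟨K, fun i => ?_⟩
  cases i with
  | zero => simpa [delay] using (abs_nonneg _).trans (hK 0)
  | succ n => exact hK n

theorem delay_injOn (a : ℕ → ℝ) : Set.InjOn (fun i : ℕ => i - 1) {i | delay a i ≠ 0} := by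
  intro i hi j hj h
  cases i with
  | zero => exact absurd rfl hi
  | succ n =>
    cases j with
    | zero => exact absurd rfl hj
    | succ m => simpa using h

/-- The semi-infinite Jacobi operator on `ℓ²(ℤ_{≥ 0})` with bounded real coefficients `a`, `b`. -/
noncomputable def jacobiHalf (a b : ℕ → ℝ) (ha : ∃ K, ∀ i, |a i| ≤ K)
    (hb : ∃ K, ∀ i, |b i| ≤ K) : Ell2 ℕ →L[ℂ] Ell2 ℕ :=
  weightedShift (delay a) (fun i => i - 1) (delay_bounded ha) (delay_injOn a)
    + weightedShift a (fun i => i + 1) ha (fun _ _ _ _ h => add_left_injective 1 h)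
    + weightedShift b id hb (Set.injOn_id _)

theorem jacobiHalf_apply_zero (a b : ℕ → ℝ) (ha : ∃ K, ∀ i, |a i| ≤ K)
    (hb : ∃ K, ∀ i, |b i| ≤ K) (x : Ell2 ℕ) :
    jacobiHalf a b ha hb x 0 = a 0 * x 1 + b 0 * x 0 := by
  change ((0 : ℝ) : ℂ) * x 0 + a 0 * x 1 + b 0 * x 0 = _
  simp

theorem jacobiHalf_apply_succ (a b : ℕ → ℝ) (ha : ∃ K, ∀ i, |a i| ≤ K)
    (hb : ∃ K, ∀ i, |b i| ≤ K) (x : Ell2 ℕ) (n : ℕ) :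
    jacobiHalf a b ha hb x (n + 1) =
      a n * x n + a (n + 1) * x (n + 2) + b (n + 1) * x (n + 1) := rfl

/-! ### The Jacobi operators of a block disordered system -/

/-- Off-diagonal entry coupling a resonator `r` with its right neighbour `r'`. -/
noncomputable def offDiag (r r' : Resonator) : ℝ :=
  -(r.speed * r'.speed / (r.spacing * √(r.length * r'.length)))

/-- Diagonal entry of a resonator `r` with left neighbour `r'`. -/
noncomputable def diag (r' r : Resonator) : ℝ :=
  r.speed ^ 2 / r.length * (1 / r'.spacing + 1 / r.spacing)

/-- Diagonal entry of a resonator at the left edge of a semi-infinite array. -/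
noncomputable def diagEdge (r : Resonator) : ℝ := r.speed ^ 2 / r.length * (1 / r.spacing)

/-- The off-diagonal coefficients of the bi-infinite array. -/
noncomputable def coeffA {D : ℕ} (B : Fin D → Block) (χ : ℤ → Fin D) (i : ℤ) : ℝ :=
  offDiag (labelSeq B χ i).res (labelSeq B χ (i + 1)).res

/-- The diagonal coefficients of the bi-infinite array. -/
noncomputable def coeffB {D : ℕ} (B : Fin D → Block) (χ : ℤ → Fin D) (i : ℤ) : ℝ :=
  diag (labelSeq B χ (i - 1)).res (labelSeq B χ i).res

/-- The off-diagonal coefficients of the semi-infinite array. -/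
noncomputable def coeffAHalf {D : ℕ} (B : Fin D → Block) (χ : ℕ → Fin D) (i : ℕ) : ℝ :=
  offDiag (labelSeqHalf B χ i).res (labelSeqHalf B χ (i + 1)).res

/-- The diagonal coefficients of the semi-infinite array, with the modified edge value. -/
noncomputable def coeffBHalf {D : ℕ} (B : Fin D → Block) (χ : ℕ → Fin D) : ℕ → ℝ
  | 0 => diagEdge (labelSeqHalf B χ 0).res
  | n + 1 => diag (labelSeqHalf B χ n).res (labelSeqHalf B χ (n + 1)).res

theorem bounded_of_finite {ι κ : Type} [Finite κ] (g : κ → ℝ) (k : ι → κ) :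
    ∃ K, ∀ i, |g (k i)| ≤ K := by
  obtain ⟨K, hK⟩ := (Set.finite_range fun p => |g p|).bddAbove
  exact ⟨K, fun i => hK ⟨k i, rfl⟩⟩

theorem coeffA_bounded {D : ℕ} (B : Fin D → Block) (χ : ℤ → Fin D) :
    ∃ K, ∀ i, |coeffA B χ i| ≤ K :=
  bounded_of_finite (fun p : Label B × Label B => offDiag p.1.res p.2.res)
    (fun i => (labelSeq B χ i, labelSeq B χ (i + 1)))

theorem coeffB_bounded {D : ℕ} (B : Fin D → Block) (χ : ℤ → Fin D) :
    ∃ K, ∀ i, |coeffB B χ i| ≤ K :=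
  bounded_of_finite (fun p : Label B × Label B => diag p.1.res p.2.res)
    (fun i => (labelSeq B χ (i - 1), labelSeq B χ i))

theorem coeffAHalf_bounded {D : ℕ} (B : Fin D → Block) (χ : ℕ → Fin D) :
    ∃ K, ∀ i, |coeffAHalf B χ i| ≤ K :=
  bounded_of_finite (fun p : Label B × Label B => offDiag p.1.res p.2.res)
    (fun i => (labelSeqHalf B χ i, labelSeqHalf B χ (i + 1)))

theorem coeffBHalf_bounded {D : ℕ} (B : Fin D → Block) (χ : ℕ → Fin D) :
    ∃ K, ∀ i, |coeffBHalf B χ i| ≤ K := by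
  obtain ⟨K, hK⟩ := bounded_of_finite (fun p : Label B × Label B => diag p.1.res p.2.res)
    (fun i => (labelSeqHalf B χ i, labelSeqHalf B χ (i + 1)))
  refine ⟨max K |coeffBHalf B χ 0|, fun i => ?_⟩
  cases i with
  | zero => exact le_max_right _ _
  | succ n => exact (hK n).trans (le_max_left _ _)

/-- The Jacobi operator `J(χ)` of a bi-infinite block sequence. -/
noncomputable def J {D : ℕ} (B : Fin D → Block) (χ : ℤ → Fin D) : Ell2 ℤ →L[ℂ] Ell2 ℤ :=
  jacobi (coeffA B χ) (coeffB B χ) (coeffA_bounded B χ) (coeffB_bounded B χ)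

/-- The positive semi-infinite Jacobi operator `J₊(χp)`. -/
noncomputable def JPlus {D : ℕ} (B : Fin D → Block) (χp : ℕ → Fin D) : Ell2 ℕ →L[ℂ] Ell2 ℕ :=
  jacobiHalf (coeffAHalf B χp) (coeffBHalf B χp) (coeffAHalf_bounded B χp)
    (coeffBHalf_bounded B χp)

/-! ### Cocycles and uniform hyperbolicity -/

/-- `SL(2, ℝ)`. -/
abbrev SL2R : Type := Matrix.SpecialLinearGroup (Fin 2) ℝ

/-- The Euclidean plane. -/
abbrev Plane : Type := EuclideanSpace ℝ (Fin 2)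

/-- The action of a matrix on the Euclidean plane. -/
noncomputable def act (A : SL2R) : Plane →ₗ[ℝ] Plane :=
  Matrix.toEuclideanLin (A : Matrix (Fin 2) (Fin 2) ℝ)

/-- `A (i + n - 1) ⋯ A (i + 1) A i`. -/
def forwardIter {G : Type} [Group G] (A : ℤ → G) : ℕ → ℤ → G
  | 0, _ => 1
  | n + 1, i => A (i + n) * forwardIter A n i

/-- The cocycle iteration `A_n(i)` for all integers `n`; for `n < 0` it is
`A (i + n)⁻¹ ⋯ A (i - 1)⁻¹ = (A_{-n}(i + n))⁻¹`. -/
def cocycleIter {G : Type} [Group G] (A : ℤ → G) : ℤ → ℤ → G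
  | Int.ofNat n, i => forwardIter A n i
  | Int.negSucc n, i => (forwardIter A (n + 1) (i - (n + 1)))⁻¹

/-- `s` and `u` are stable and unstable directions of the cocycle `P`: both are invariant lines,
and `s` (resp. `u`) decays uniformly exponentially forwards (resp. backwards). -/
structure IsHyperbolicSplitting (P : ℤ → SL2R) (s u : ℤ → Projectivization ℝ Plane) : Prop where
  map_u : ∀ i, (u i).submodule.map (act (P i)) = (u (i + 1)).submodule
  map_s : ∀ i, (s i).submodule.map (act (P i)) = (s (i + 1)).submodule
  growth : ∃ C > 0, ∃ η > 1, ∀ (i : ℤ) (n : ℕ),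
    (∀ x ∈ (u i).submodule, ‖x‖ = 1 → ‖act (cocycleIter P (-(n : ℤ)) i) x‖ ≤ C * (η ^ n)⁻¹) ∧
    (∀ x ∈ (s i).submodule, ‖x‖ = 1 → ‖act (cocycleIter P (n : ℤ) i) x‖ ≤ C * (η ^ n)⁻¹)

/-- Uniform hyperbolicity of a bounded `SL(2, ℝ)`-cocycle. -/
def UniformlyHyperbolic (P : ℤ → SL2R) : Prop :=
  (∃ K : ℝ, ∀ i k l, |(P i : Matrix (Fin 2) (Fin 2) ℝ) k l| ≤ K) ∧
    ∃ s u : ℤ → Projectivization ℝ Plane, IsHyperbolicSplitting P s u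

/-! ### Propagation matrices -/

/-- The propagation matrix of a single resonator. -/
noncomputable def propMat (lam : ℝ) (r : Resonator) : SL2R :=
  ⟨!![1 - r.spacing * (r.length / r.speed ^ 2) * lam, r.spacing;
      -(r.length / r.speed ^ 2) * lam, 1],
    by rw [Matrix.det_fin_two_of]; ring⟩

/-- The resonator propagation matrix cocycle `P^λ`. -/
noncomputable def resCocycle {D : ℕ} (B : Fin D → Block) (χ : ℤ → Fin D) (lam : ℝ) (i : ℤ) :
    SL2R :=
  propMat lam (labelSeq B χ i).res

/-- The block propagation matrix: the ordered product `P_len ⋯ P_2 P_1` of the propagation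
matrices of the resonators of the block, so that the leftmost resonator acts first. -/
noncomputable def blockPropMat (lam : ℝ) (b : Block) : SL2R :=
  (List.ofFn fun k => propMat lam (b.res k)).reverse.prod

/-- The block propagation matrix cocycle. -/
noncomputable def blockCocycle {D : ℕ} (B : Fin D → Block) (χ : ℤ → Fin D) (lam : ℝ) (j : ℤ) :
    SL2R :=
  blockPropMat lam (B (χ j))

/-- The change of basis from `(v⁽ⁱ⁾, v⁽ⁱ⁻¹⁾)` to the value and the exterior derivative at the left
end of the `i`-th resonator `r`, whose left neighbour is `r'`. -/
noncomputable def conjMat (r' r : Resonator) : Matrix (Fin 2) (Fin 2) ℝ :=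
  !![r.speed / √r.length, 0;
     r.speed / (√r.length * r'.spacing), -(r'.speed / (√r'.length * r'.spacing))]

/-- The conjugacy sequence `Q`. -/
noncomputable def conjSeq {D : ℕ} (B : Fin D → Block) (χ : ℤ → Fin D) (i : ℤ) :
    Matrix (Fin 2) (Fin 2) ℝ :=
  conjMat (labelSeq B χ (i - 1)).res (labelSeq B χ i).res

/-- The vector `Q(i)⁻¹ P_i^λ(0) (1, 0)ᵀ`. -/
noncomputable def edgeVec {D : ℕ} (B : Fin D → Block) (χ : ℤ → Fin D) (lam : ℝ) (i : ℤ) :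
    Fin 2 → ℝ :=
  ((conjSeq B χ i)⁻¹ *
    ((cocycleIter (resCocycle B χ lam) i 0 : SL2R) : Matrix (Fin 2) (Fin 2) ℝ)).mulVec ![1, 0]

/-- `λ` is an eigenvalue of multiplicity one of `J₊(χp)`, and the sequence `v` determined by
`(v⁽ⁱ⁾, v⁽ⁱ⁻¹⁾)ᵀ = Q(i)⁻¹ P_i^λ(0) (1, 0)ᵀ` (with `Q` and `P^λ` those of `χ'`) is an eigenvector
in `ℓ²(ℤ_{≥ 0})`. For `i = 0` only the first component concerns `v`. -/
def IsSimpleEdgeEigenvalue {D : ℕ} (B : Fin D → Block) (χp : ℕ → Fin D) (χ' : ℤ → Fin D)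
    (lam : ℝ) : Prop :=
  Module.finrank ℂ
      (Module.End.eigenspace (JPlus B χp : Ell2 ℕ →ₗ[ℂ] Ell2 ℕ) (lam : ℂ)) = 1 ∧
    ∃ v : Ell2 ℕ,
      (∀ i : ℕ, v i = (edgeVec B χ' lam (i : ℤ) 0 : ℂ)) ∧
      (∀ i : ℕ, v i = (edgeVec B χ' lam ((i : ℤ) + 1) 1 : ℂ)) ∧
      Module.End.HasEigenvector (JPlus B χp : Ell2 ℕ →ₗ[ℂ] Ell2 ℕ) (lam : ℂ) v

end BlockDisorder

open BlockDisorder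

namespace BlockDisorder

/-! ### Cocycles and their orbits -/

/-! Everything rests on one fact: off the spectrum of `J B χ'` the equation `(J - λ) x = 0` has a
solution decaying at `+∞` and one decaying at `-∞`, and this dichotomy, read through the states `w
i` (value and exterior derivative), is a hyperbolic splitting.

The resolvent is used only through `HasGreen`: a lower bound for `J - λ` and a square summable
response to each unit forcing. Cutting off a solution that is square summable at `+∞` leaves a
forcing at two sites, so the tail is controlled by the state at the cut; a tail dominated by its
first term decays geometrically (`HasGreen.decay`). Such solutions exist because the responses to
forcings at `0` and `1` cannot both vanish on the right: their Wronskian would be a nonzero constant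
on the left (`HasGreen.exists_right`). Reflection supplies the other end. Finitely many resonators
make the states uniformly comparable to pairs of field values, and block edges are at least as far
apart as their block indices, so both orbits sampled there contract uniformly (`exists_contraction`,
`exists_splitting`).

On the half-line, row `0` of `J₊ - λ` applied to the field of an orbit gives minus the weight of
resonator `0` times `w 0 1` (`IsOrbit.edge_row`), so eigenvectors are exactly the square summable
multiples of the field of the orbit of `(1, 0)`. By `mem_stable_iff` that field is square summable
iff `(1, 0)` lies in the stable line. If it is not, `λ - J₊` is bijective: the full-line resolvent
solves all rows but the first, and a multiple of the decaying orbit repairs that one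
(`not_mem_spectrum_JPlus`). -/

theorem forwardIter_succ_left {G : Type} [Group G] (A : ℤ → G) (n : ℕ) (i : ℤ) :
    forwardIter A (n + 1) i = forwardIter A n (i + 1) * A i := by
  induction n with
  | zero => simp [forwardIter]
  | succ n ih =>
    rw [forwardIter, ih, forwardIter, mul_assoc]
    congr 2
    push_cast
    ring

/-- One recursion valid for positive and negative times alike, so that later arguments need no case
split on the sign. -/
theorem cocycleIter_succ_zero {G : Type} [Group G] (A : ℤ → G) (i : ℤ) :
    cocycleIter A (i + 1) 0 = A i * cocycleIter A i 0 := by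
  match i with
  | Int.ofNat n =>
    change forwardIter A (n + 1) 0 = A n * forwardIter A n 0
    simp [forwardIter]
  | Int.negSucc 0 =>
    change forwardIter A 0 0 = _ * (forwardIter A 1 _)⁻¹
    simp [forwardIter]
  | Int.negSucc (n + 1) =>
    have h : Int.negSucc (n + 1) + 1 = Int.negSucc n := by omega
    rw [h]
    change (forwardIter A (n + 1) _)⁻¹ = _ * (forwardIter A (n + 2) _)⁻¹
    rw [forwardIter_succ_left A (n + 1), mul_inv_rev, ← mul_assoc]
    have h1 : A (Int.negSucc (n + 1)) * (A (0 - (((n + 1 : ℕ) : ℤ) + 1)))⁻¹ = 1 := by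
      rw [mul_inv_eq_one]
      congr 1
    rw [h1, one_mul]
    congr 2

theorem act_apply (A : SL2R) (x : Plane) :
    act A x = WithLp.toLp 2 ((A : Matrix (Fin 2) (Fin 2) ℝ).mulVec x.ofLp) := rfl

theorem act_mul (A B : SL2R) (x : Plane) : act (A * B) x = act A (act B x) := by
  rw [act_apply, act_apply, act_apply, Matrix.mulVec_mulVec, Matrix.SpecialLinearGroup.coe_mul]

theorem act_one (x : Plane) : act 1 x = x := by
  simp [act_apply]

theorem act_inv_act (A : SL2R) (x : Plane) : act A⁻¹ (act A x) = x := by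
  rw [← act_mul, inv_mul_cancel, act_one]

theorem act_act_inv (A : SL2R) (x : Plane) : act A (act A⁻¹ x) = x := by
  rw [← act_mul, mul_inv_cancel, act_one]

/-- `w` is an orbit of the cocycle `P`. -/
def IsOrbit (P : ℤ → SL2R) (w : ℤ → Plane) : Prop := ∀ i, w (i + 1) = act (P i) (w i)

theorem IsOrbit.forwardIter {P : ℤ → SL2R} {w : ℤ → Plane} (hw : IsOrbit P w) (n : ℕ) (i : ℤ) :
    act (forwardIter P n i) (w i) = w (i + n) := by
  induction n with
  | zero => simp [BlockDisorder.forwardIter, act_one]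
  | succ n ih =>
    rw [BlockDisorder.forwardIter, act_mul, ih, ← hw (i + n)]
    congr 1
    push_cast
    ring

theorem cocycleIter_natCast {G : Type} [Group G] (A : ℤ → G) (n : ℕ) (i : ℤ) :
    cocycleIter A n i = forwardIter A n i := rfl

theorem cocycleIter_neg_natCast {G : Type} [Group G] (A : ℤ → G) (n : ℕ) (i : ℤ) :
    cocycleIter A (-(n : ℤ)) i = (forwardIter A n (i - n))⁻¹ := by
  cases n with
  | zero => change (1 : G) = _; simp [forwardIter]
  | succ n => change (forwardIter A (n + 1) (i - (n + 1)))⁻¹ = _; push_cast; rfl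

theorem IsOrbit.cocycleIter_neg {P : ℤ → SL2R} {w : ℤ → Plane} (hw : IsOrbit P w) (n : ℕ)
    (i : ℤ) : act (cocycleIter P (-(n : ℤ)) i) (w i) = w (i - n) := by
  rw [cocycleIter_neg_natCast]
  have h := hw.forwardIter n (i - n)
  rw [sub_add_cancel] at h
  rw [← h, act_inv_act]

/-- There is an orbit through every point. -/
theorem exists_isOrbit (P : ℤ → SL2R) (k : ℤ) (x : Plane) : ∃ w, IsOrbit P w ∧ w k = x := by
  refine ⟨fun i => act (cocycleIter P i 0) (act (cocycleIter P k 0)⁻¹ x), fun i => ?_,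
    act_act_inv _ _⟩
  simp only [cocycleIter_succ_zero, act_mul]

theorem IsOrbit.ne_zero {P : ℤ → SL2R} {w : ℤ → Plane} (hw : IsOrbit P w) {k : ℤ}
    (hk : w k ≠ 0) (i : ℤ) : w i ≠ 0 := by
  have key : ∀ j, w (j + 1) = 0 ↔ w j = 0 := fun j => by
    rw [hw j]
    refine ⟨fun h => ?_, fun h => by rw [h, map_zero]⟩
    rw [← act_inv_act (P j) (w j), h, map_zero]
  intro hi
  apply hk
  obtain ⟨n, rfl | rfl⟩ : ∃ n : ℕ, k = i + n ∨ i = k + n := by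
    rcases le_total i k with h | h
    · exact ⟨(k - i).toNat, Or.inl (by omega)⟩
    · exact ⟨(i - k).toNat, Or.inr (by omega)⟩
  · clear hk
    induction n with
    | zero => simpa using hi
    | succ n ih => rw [Nat.cast_succ, ← add_assoc, key]; exact ih
  · clear hk
    induction n with
    | zero => simpa using hi
    | succ n ih => rw [Nat.cast_succ, ← add_assoc, key] at hi; exact ih hi

/-! ### Hyperbolic splittings -/

theorem IsHyperbolicSplitting.map_forwardIter_u {P : ℤ → SL2R}
    {s u : ℤ → Projectivization ℝ Plane} (h : IsHyperbolicSplitting P s u) {x : Plane}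
    (hx : x ∈ (u 0).submodule) (n : ℕ) : act (forwardIter P n 0) x ∈ (u n).submodule := by
  induction n with
  | zero => simpa [forwardIter, act_one] using hx
  | succ n ih =>
    rw [forwardIter, act_mul, Nat.cast_succ, ← h.map_u, zero_add]
    exact Submodule.mem_map_of_mem ih

theorem norm_le_of_unit_bound {V : Submodule ℝ Plane} {f : Plane →ₗ[ℝ] Plane} {c : ℝ}
    (hf : ∀ x ∈ V, ‖x‖ = 1 → ‖f x‖ ≤ c) {x : Plane} (hx : x ∈ V) : ‖f x‖ ≤ c * ‖x‖ := by
  by_cases h0 : x = 0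
  · simp [h0]
  have hn : 0 < ‖x‖ := norm_pos_iff.2 h0
  have h1 := hf (‖x‖⁻¹ • x) (V.smul_mem _ hx) (by simp [norm_smul, hn.ne'])
  rw [map_smul, norm_smul, norm_inv, norm_norm] at h1
  rwa [inv_mul_le_iff₀ hn, mul_comm] at h1

theorem Projectivization.exists_submodule_eq_span (p : Projectivization ℝ Plane) :
    ∃ x : Plane, x ≠ 0 ∧ p.submodule = Submodule.span ℝ {x} :=
  ⟨p.rep, p.rep_nonzero, p.submodule_eq⟩

/-- A vector whose forward orbit stays bounded lies in the stable direction. -/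
theorem IsHyperbolicSplitting.mem_stable_of_bounded {P : ℤ → SL2R}
    {s u : ℤ → Projectivization ℝ Plane} (h : IsHyperbolicSplitting P s u) {x : Plane} {K : ℝ}
    (hx : ∀ n : ℕ, ‖act (forwardIter P n 0) x‖ ≤ K) : x ∈ (s 0).submodule := by
  obtain ⟨C, hC, η, hη, hg⟩ := h.growth
  have hη0 : 0 < η := by linarith
  have hs : ∀ y ∈ (s 0).submodule, ∀ n : ℕ,
      ‖act (forwardIter P n 0) y‖ ≤ C * ‖y‖ := fun y hy n => by
    refine (norm_le_of_unit_bound (hg 0 n).2 hy).trans ?_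
    gcongr
    exact mul_le_of_le_one_right hC.le (inv_le_one_of_one_le₀ (one_le_pow₀ hη.le))
  -- vectors of the unstable direction grow
  have hu : ∀ y ∈ (u 0).submodule, ∀ K' : ℝ, (∀ n : ℕ, ‖act (forwardIter P n 0) y‖ ≤ K') →
      y = 0 := fun y hy K' hK' => by
    -- Pulling the point reached at time `n` back to time `0` stays on the unstable line and gains a
    -- factor `C η⁻ⁿ`.
    have hle : ∀ n : ℕ, ‖y‖ ≤ C * K' * (η⁻¹) ^ n := fun n => by
      have h1 := norm_le_of_unit_bound (hg n n).1 (h.map_forwardIter_u hy n)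
      rw [cocycleIter_neg_natCast, sub_self, act_inv_act] at h1
      refine h1.trans ?_
      rw [inv_pow, mul_right_comm]
      gcongr
      exact hK' n
    have hlim : Filter.Tendsto (fun n : ℕ => C * K' * (η⁻¹) ^ n) Filter.atTop (nhds 0) := by
      simpa using (tendsto_pow_atTop_nhds_zero_of_lt_one (inv_nonneg.2 hη0.le)
        (inv_lt_one_of_one_lt₀ hη)).const_mul (C * K')
    exact norm_le_zero_iff.1 (ge_of_tendsto' hlim hle)
  obtain ⟨y, hy0, hy⟩ := Projectivization.exists_submodule_eq_span (s 0)
  obtain ⟨z, hz0, hz⟩ := Projectivization.exists_submodule_eq_span (u 0)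
  have hymem : y ∈ (s 0).submodule := hy ▸ Submodule.mem_span_singleton_self y
  have hzmem : z ∈ (u 0).submodule := hz ▸ Submodule.mem_span_singleton_self z
  -- A common vector of both lines would have a bounded forward orbit and so vanish; hence the two
  -- lines span the plane.
  have hli : LinearIndependent ℝ ![y, z] := by
    rw [LinearIndependent.pair_iff' hy0]
    rintro c rfl
    exact hz0 (hu _ hzmem _ (hs _ (Submodule.smul_mem _ c hymem)))
  have hspan := hli.span_eq_top_of_card_eq_finrank (by simp)
  have hxm : x ∈ Submodule.span ℝ (Set.range ![y, z]) := hspan ▸ Submodule.mem_top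
  rw [Matrix.range_cons, Matrix.range_cons, Matrix.range_empty, Set.union_empty,
    Set.singleton_union, Submodule.mem_span_pair] at hxm
  obtain ⟨c, d, rfl⟩ := hxm
  have hd : d • z = 0 := hu _ (Submodule.smul_mem _ d hzmem) (K + C * ‖c • y‖) fun n => by
    have h1 : act (forwardIter P n 0) (d • z) = act (forwardIter P n 0) (c • y + d • z)
        - act (forwardIter P n 0) (c • y) := by rw [← map_sub, add_sub_cancel_left]
    rw [h1]
    exact (norm_sub_le _ _).trans (add_le_add (hx n) (hs _ (Submodule.smul_mem _ c hymem) n))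
  rw [hd, add_zero]
  exact Submodule.smul_mem _ c hymem

/-- Two orbits contracting exponentially, one forwards and one backwards, make up a hyperbolic
splitting. -/
theorem IsOrbit.isHyperbolicSplitting {P : ℤ → SL2R} {ws wu : ℤ → Plane} (hs : IsOrbit P ws)
    (hu : IsOrbit P wu) (hs0 : ∀ i, ws i ≠ 0) (hu0 : ∀ i, wu i ≠ 0) {C η : ℝ} (hC : 0 < C)
    (hη : 1 < η) (hsd : ∀ (i : ℤ) (n : ℕ), ‖ws (i + n)‖ ≤ C * (η ^ n)⁻¹ * ‖ws i‖)
    (hud : ∀ (i : ℤ) (n : ℕ), ‖wu (i - n)‖ ≤ C * (η ^ n)⁻¹ * ‖wu i‖) :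
    IsHyperbolicSplitting P (fun i => Projectivization.mk ℝ (ws i) (hs0 i))
      (fun i => Projectivization.mk ℝ (wu i) (hu0 i)) := by
  refine ⟨fun i => ?_, fun i => ?_, C, hC, η, hη, fun i n => ⟨fun x hx hx1 => ?_,
    fun x hx hx1 => ?_⟩⟩
  · simp only [Projectivization.submodule_mk, Submodule.map_span, Set.image_singleton, hu i]
  · simp only [Projectivization.submodule_mk, Submodule.map_span, Set.image_singleton, hs i]
  · rw [Projectivization.submodule_mk, Submodule.mem_span_singleton] at hx
    obtain ⟨c, rfl⟩ := hx
    rw [map_smul, hu.cocycleIter_neg, norm_smul]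
    rw [norm_smul] at hx1
    calc ‖c‖ * ‖wu (i - n)‖ ≤ ‖c‖ * (C * (η ^ n)⁻¹ * ‖wu i‖) := by gcongr; exact hud i n
      _ = C * (η ^ n)⁻¹ := by rw [mul_left_comm, hx1, mul_one]
  · rw [Projectivization.submodule_mk, Submodule.mem_span_singleton] at hx
    obtain ⟨c, rfl⟩ := hx
    rw [map_smul, cocycleIter_natCast, hs.forwardIter, norm_smul]
    rw [norm_smul] at hx1
    calc ‖c‖ * ‖ws (i + n)‖ ≤ ‖c‖ * (C * (η ^ n)⁻¹ * ‖ws i‖) := by gcongr; exact hsd i n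
      _ = C * (η ^ n)⁻¹ := by rw [mul_left_comm, hx1, mul_one]

/-! ### Places -/

theorem Place.ext' {D : ℕ} {B : Fin D → Block} {ι : Type} {χ : ι → Fin D} {p q : Place B χ}
    (h₁ : p.1 = q.1) (h₂ : (p.2 : ℕ) = q.2) : p = q := by
  obtain ⟨j, r⟩ := p
  obtain ⟨k, t⟩ := q
  obtain rfl : j = k := h₁
  exact congrArg _ (Fin.ext h₂)

theorem Label.ext' {D : ℕ} {B : Fin D → Block} {p q : Label B}
    (h₁ : p.1 = q.1) (h₂ : (p.2 : ℕ) = q.2) : p = q := by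
  obtain ⟨j, r⟩ := p
  obtain ⟨k, t⟩ := q
  obtain rfl : j = k := h₁
  exact congrArg _ (Fin.ext h₂)

/-- Since the two moves are mutually inverse, `placeAt` obeys a single recursion on all of `ℤ`,
although it is defined separately on either side of `0`. -/
theorem Place.next_prev {D : ℕ} {B : Fin D → Block} {χ : ℤ → Fin D} (p : Place B χ) :
    p.prev.next = p := by
  have hlen := (B (χ (p.1 - 1))).len_pos
  have hlt := p.2.isLt
  by_cases h : (p.2 : ℕ) = 0
  · have h1 : p.prev = ⟨p.1 - 1, ⟨(B (χ (p.1 - 1))).len - 1, by omega⟩⟩ := by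
      simp [Place.prev, h]
    rw [h1, Place.next, dif_neg (by simp only; omega)]
    exact Place.ext' (by simp) (by simp [h])
  · have h1 : p.prev = ⟨p.1, ⟨(p.2 : ℕ) - 1, by omega⟩⟩ := by simp [Place.prev, h]
    rw [h1, Place.next, dif_pos (by simp only; omega)]
    exact Place.ext' (by simp) (by simp only; omega)

theorem Place.prev_next {D : ℕ} {B : Fin D → Block} {χ : ℤ → Fin D} (p : Place B χ) :
    p.next.prev = p := by
  have hlt := p.2.isLt
  by_cases h : (p.2 : ℕ) + 1 < (B (χ p.1)).len
  · have h1 : p.next = ⟨p.1, ⟨(p.2 : ℕ) + 1, h⟩⟩ := by simp [Place.next, h]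
    rw [h1]
    simp [Place.prev]
  · have h1 : p.next = ⟨p.1 + 1, ⟨0, (B (χ (p.1 + 1))).len_pos⟩⟩ := by simp [Place.next, h]
    rw [h1]
    simp only [Place.prev, if_true]
    refine Place.ext' (by simp) ?_
    simp only [add_sub_cancel_right]
    omega

theorem placeAt_succ {D : ℕ} (B : Fin D → Block) (χ : ℤ → Fin D) (i : ℤ) :
    placeAt B χ (i + 1) = (placeAt B χ i).next := by
  match i with
  | Int.ofNat n => exact Function.iterate_succ_apply' _ _ _
  | Int.negSucc 0 => exact (Place.next_prev _).symm
  | Int.negSucc (n + 1) =>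
    have h : Int.negSucc (n + 1) + 1 = Int.negSucc n := by omega
    rw [h]
    change Place.prev^[n + 1] _ = (Place.prev^[n + 2] _).next
    rw [Function.iterate_succ_apply' Place.prev (n + 1), Place.next_prev]

theorem placeAt_eq_prev {D : ℕ} (B : Fin D → Block) (χ : ℤ → Fin D) (i : ℤ) :
    placeAt B χ (i - 1) = (placeAt B χ i).prev := by
  have h := placeAt_succ B χ (i - 1)
  rw [sub_add_cancel] at h
  rw [h, Place.prev_next]

/-! ### Block edges inside the resonator sequence -/

/-- The index of the first resonator of the `j`-th block. -/
def blockStart {D : ℕ} (B : Fin D → Block) (χ : ℤ → Fin D) (j : ℤ) : ℤ :=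
  (cocycleIter (fun k => Multiplicative.ofAdd ((B (χ k)).len : ℤ)) j 0).toAdd

theorem blockStart_zero {D : ℕ} (B : Fin D → Block) (χ : ℤ → Fin D) : blockStart B χ 0 = 0 := rfl

/-- Block lengths form a cocycle with values in `Multiplicative ℤ`, so its iterates are the signed
partial sums in both directions. -/
theorem blockStart_succ {D : ℕ} (B : Fin D → Block) (χ : ℤ → Fin D) (j : ℤ) :
    blockStart B χ (j + 1) = blockStart B χ j + (B (χ j)).len := by
  rw [blockStart, cocycleIter_succ_zero, add_comm]
  rfl

theorem placeAt_add {D : ℕ} {B : Fin D → Block} {χ : ℤ → Fin D} {i j : ℤ}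
    (h : placeAt B χ i = ⟨j, ⟨0, (B (χ j)).len_pos⟩⟩) (r : ℕ) (hr : r < (B (χ j)).len) :
    placeAt B χ (i + r) = ⟨j, ⟨r, hr⟩⟩ := by
  induction r with
  | zero => simpa using h
  | succ r ih =>
    rw [Nat.cast_succ, ← add_assoc, placeAt_succ, ih (by omega), Place.next, dif_pos hr]

theorem placeAt_sub {D : ℕ} {B : Fin D → Block} {χ : ℤ → Fin D} {i j : ℤ} {m : ℕ}
    {hm : m < (B (χ j)).len} (h : placeAt B χ i = ⟨j, ⟨m, hm⟩⟩) :
    placeAt B χ (i - m) = ⟨j, ⟨0, (B (χ j)).len_pos⟩⟩ := by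
  induction m generalizing i with
  | zero => simpa using h
  | succ m ih =>
    have h1 : placeAt B χ (i - 1) = ⟨j, ⟨m, by omega⟩⟩ := by
      rw [placeAt_eq_prev, h]; simp [Place.prev]
    rw [← ih h1]
    congr 1
    push_cast
    ring

theorem placeAt_blockStart {D : ℕ} (B : Fin D → Block) (χ : ℤ → Fin D) (j : ℤ) :
    placeAt B χ (blockStart B χ j) = ⟨j, ⟨0, (B (χ j)).len_pos⟩⟩ := by
  induction j with
  | zero => rfl
  | succ j ih =>
    have hl := (B (χ j)).len_pos
    rw [blockStart_succ]
    have h := placeAt_add ih ((B (χ j)).len - 1) (by omega)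
    have h2 : blockStart B χ j + ((B (χ j)).len : ℤ)
        = blockStart B χ j + (((B (χ j)).len - 1 : ℕ) : ℤ) + 1 := by omega
    rw [h2, placeAt_succ, h, Place.next, dif_neg (by simp only; omega)]
  | pred j ih =>
    have hl := (B (χ (-(j : ℤ) - 1))).len_pos
    have hs := blockStart_succ B χ (-(j : ℤ) - 1)
    rw [sub_add_cancel] at hs
    have h1 : placeAt B χ (blockStart B χ (-(j : ℤ)) - 1)
        = ⟨-(j : ℤ) - 1, ⟨(B (χ (-(j : ℤ) - 1))).len - 1, by omega⟩⟩ := by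
      rw [placeAt_eq_prev, ih]; simp [Place.prev]
    rw [← placeAt_sub h1]
    congr 1
    omega

theorem blockStart_add_le {D : ℕ} (B : Fin D → Block) (χ : ℤ → Fin D) (j : ℤ) (n : ℕ) :
    blockStart B χ j + n ≤ blockStart B χ (j + n) := by
  induction n with
  | zero => simp
  | succ n ih =>
    have := (B (χ (j + n))).len_pos
    rw [Nat.cast_succ, ← add_assoc j, blockStart_succ]
    omega

theorem act_reverse_prod_ofFn {n : ℕ} (f : Fin n → SL2R) (g : ℕ → Plane)
    (h : ∀ k : Fin n, g (k + 1) = act (f k) (g k)) :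
    act (List.ofFn f).reverse.prod (g 0) = g n := by
  induction n with
  | zero => simp [act_one]
  | succ n ih =>
    rw [List.ofFn_succ', List.concat_eq_append, List.reverse_append, List.reverse_singleton,
      List.singleton_append, List.prod_cons, act_mul, ih _ fun k => h k.castSucc]
    exact (h (Fin.last n)).symm

theorem resCocycle_blockStart_add {D : ℕ} (B : Fin D → Block) (χ : ℤ → Fin D) (lam : ℝ) (j : ℤ)
    (k : Fin (B (χ j)).len) :
    resCocycle B χ lam (blockStart B χ j + k) = propMat lam ((B (χ j)).res k) := by
  rw [resCocycle, labelSeq, placeAt_add (placeAt_blockStart B χ j) k k.isLt]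
  rfl

/-- Sampling an orbit of the resonator cocycle at the block edges gives an orbit of the block
cocycle. -/
theorem IsOrbit.blockStart {D : ℕ} {B : Fin D → Block} {χ : ℤ → Fin D} {lam : ℝ}
    {w : ℤ → Plane} (hw : IsOrbit (resCocycle B χ lam) w) :
    IsOrbit (blockCocycle B χ lam) fun j => w (blockStart B χ j) := by
  intro j
  have h := act_reverse_prod_ofFn (fun k => propMat lam ((B (χ j)).res k))
    (fun r => w (BlockDisorder.blockStart B χ j + r)) fun k => by
      rw [← resCocycle_blockStart_add B χ lam j k, ← hw]
      push_cast
      rw [add_assoc]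
  simp only [Nat.cast_zero, add_zero] at h
  simp only [blockCocycle, blockPropMat, h, blockStart_succ]

/-! ### Half-line sequences -/

/-- Compared componentwise, since places over `χp` and over `χ'` live in different types. -/
theorem placeAtHalf_eq {D : ℕ} {B : Fin D → Block} {χp : ℕ → Fin D} {χ' : ℤ → Fin D}
    (hext : Extends χp χ') (n : ℕ) :
    (placeAt B χ' n).1 = ((placeAtHalf B χp n).1 : ℤ) ∧
      ((placeAt B χ' n).2 : ℕ) = (placeAtHalf B χp n).2 := by
  induction n with
  | zero => exact ⟨rfl, rfl⟩
  | succ n ih =>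
    have h1 : placeAtHalf B χp (n + 1) = (placeAtHalf B χp n).next :=
      Function.iterate_succ_apply' _ _ _
    rw [h1, Nat.cast_succ, placeAt_succ]
    obtain ⟨ih1, ih2⟩ := ih
    have h3 : (B (χ' (placeAt B χ' n).1)).len = (B (χp (placeAtHalf B χp n).1)).len := by
      rw [ih1, hext]
    by_cases h : ((placeAtHalf B χp n).2 : ℕ) + 1 < (B (χp (placeAtHalf B χp n).1)).len
    · rw [Place.next, Place.next, dif_pos h, dif_pos (by omega)]
      exact ⟨ih1, by simp [ih2]⟩
    · rw [Place.next, Place.next, dif_neg h, dif_neg (by omega)]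
      exact ⟨by simp [ih1], rfl⟩

theorem labelSeqHalf_eq {D : ℕ} {B : Fin D → Block} {χp : ℕ → Fin D} {χ' : ℤ → Fin D}
    (hext : Extends χp χ') (n : ℕ) : labelSeqHalf B χp n = labelSeq B χ' n := by
  obtain ⟨h1, h2⟩ := placeAtHalf_eq (B := B) hext n
  refine Label.ext' ?_ h2.symm
  change χp _ = χ' _
  rw [h1, hext]

/-! ### Square summable solutions of Jacobi equations -/

/-- The Jacobi difference expression. -/
def jacobiForm (a b x : ℤ → ℝ) (i : ℤ) : ℝ := a (i - 1) * x (i - 1) + a i * x (i + 1) + b i * x i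

/-- The coefficient `a j` belongs to the bond between `j` and `j + 1`, so reflection sends it to `a
(-j - 1)`. Statements at `-∞` thereby follow from those at `+∞`. -/
theorem jacobiForm_reflect (a b x : ℤ → ℝ) (i : ℤ) :
    jacobiForm (fun j => a (-j - 1)) (fun j => b (-j)) (fun j => x (-j)) i
      = jacobiForm a b x (-i) := by
  simp only [jacobiForm, show -(i - 1) = -i + 1 by ring, show -(i + 1) = -i - 1 by ring,
    add_sub_cancel_right]
  ring

/-- The Jacobi expression is bounded below on square summable sequences, and every unit forcing
has a square summable solution. -/
structure HasGreen (a b : ℤ → ℝ) (M : ℝ) : Prop where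
  bound : ∀ x : ℤ → ℝ, (Summable fun i => x i ^ 2) →
    ∑' i, x i ^ 2 ≤ M * ∑' i, jacobiForm a b x i ^ 2
  solve : ∀ k : ℤ, ∃ x : ℤ → ℝ, (Summable fun i => x i ^ 2) ∧
    ∀ i, jacobiForm a b x i = if i = k then 1 else 0

theorem HasGreen.reflect {a b : ℤ → ℝ} {M : ℝ} (h : HasGreen a b M) :
    HasGreen (fun j => a (-j - 1)) (fun j => b (-j)) M where
  bound x hx := by
    have h1 := h.bound (fun i => x (-i)) ((Equiv.neg ℤ).summable_iff.2 hx)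
    have h2 : ∀ i, jacobiForm (fun j => a (-j - 1)) (fun j => b (-j)) x i
        = jacobiForm a b (fun i => x (-i)) (-i) := fun i => by
      rw [← jacobiForm_reflect]; simp
    simp only [h2]
    have h3 := (Equiv.neg ℤ).tsum_eq (fun i => jacobiForm a b (fun i => x (-i)) i ^ 2)
    simp only [Equiv.neg_apply] at h3
    rw [h3]
    refine le_trans (le_of_eq ?_) h1
    exact ((Equiv.neg ℤ).tsum_eq fun i => x i ^ 2).symm
  solve k := by
    obtain ⟨x, hx, hk⟩ := h.solve (-k)
    refine ⟨fun i => x (-i), (Equiv.neg ℤ).summable_iff.2 hx, fun i => ?_⟩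
    rw [jacobiForm_reflect, hk]
    simp

/-- Square summability at `+∞`. -/
def RightSq (x : ℤ → ℝ) : Prop := ∀ m : ℤ, Summable fun n : ℕ => x (m + n) ^ 2

theorem rightSq_of_summable {x : ℤ → ℝ} {m : ℤ} (h : Summable fun n : ℕ => x (m + n) ^ 2) :
    RightSq x := by
  intro k
  obtain ⟨n, rfl | rfl⟩ : ∃ n : ℕ, k = m + n ∨ m = k + n := by
    rcases le_total m k with h | h
    · exact ⟨(k - m).toNat, Or.inl (by omega)⟩
    · exact ⟨(m - k).toNat, Or.inr (by omega)⟩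
  · refine ((summable_nat_add_iff n).2 h).congr fun r => ?_
    rw [Nat.cast_add, add_assoc, add_comm (r : ℤ)]
  · refine (summable_nat_add_iff n).1 (h.congr fun r => ?_)
    rw [Nat.cast_add, add_assoc, add_comm (r : ℤ)]

theorem RightSq.of_summable {x : ℤ → ℝ} (h : Summable fun i => x i ^ 2) : RightSq x :=
  fun m => h.comp_injective (i := fun n : ℕ => m + (n : ℤ)) fun p q hpq => by simpa using hpq

/-- The tail of a solution is controlled by its state at the cut. -/
theorem HasGreen.tsum_tail_le {a b : ℤ → ℝ} {M A : ℝ} (h : HasGreen a b M) (hM : 0 ≤ M)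
    (hA : ∀ i, |a i| ≤ A) {x : ℤ → ℝ} (hx : RightSq x) (hsol : ∀ i, jacobiForm a b x i = 0)
    (m : ℤ) : ∑' n : ℕ, x (m + n) ^ 2 ≤ M * A ^ 2 * (x (m - 1) ^ 2 + x m ^ 2) := by
  set y : ℤ → ℝ := fun i => if m ≤ i then x i else 0 with hy
  have hinj : Function.Injective fun n : ℕ => m + (n : ℤ) := fun p q hpq => by simpa using hpq
  have hrange : ∀ i, i ∉ Set.range (fun n : ℕ => m + (n : ℤ)) → y i ^ 2 = 0 := fun i hi => by
    have : ¬ m ≤ i := fun hmi => hi ⟨(i - m).toNat, by simp only; omega⟩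
    simp [hy, this]
  have hyx : ∀ n : ℕ, y (m + n) ^ 2 = x (m + n) ^ 2 := fun n => by simp [hy]
  have hsum : Summable fun i => y i ^ 2 :=
    (hinj.summable_iff hrange).1 ((hx m).congr fun n => (hyx n).symm)
  have htsum : ∑' n : ℕ, x (m + n) ^ 2 = ∑' i, y i ^ 2 := by
    rw [← hinj.tsum_eq (f := fun i => y i ^ 2)
      (Function.support_subset_iff'.2 hrange)]
    exact tsum_congr fun n => (hyx n).symm
  -- Only the severed bond `a (m - 1)` is felt: the truncated solution is forced at its two ends `m
  -- - 1` and `m` and nowhere else.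
  have hL : ∀ i, jacobiForm a b y i
      = if i = m - 1 then a (m - 1) * x m else if i = m then -(a (m - 1) * x (m - 1)) else 0 := by
    intro i
    have hs := hsol i
    unfold jacobiForm at hs ⊢
    simp only [hy]
    rcases lt_trichotomy i (m - 1) with hi | rfl | hi
    · rw [if_neg (by omega), if_neg (by omega), if_neg (by omega), if_neg (by omega),
        if_neg (by omega)]
      ring
    · rw [if_neg (by omega), if_pos (by omega), if_neg (by omega), if_pos rfl, sub_add_cancel]
      ring
    · rcases eq_or_ne i m with rfl | hne
      · rw [if_neg (by omega), if_pos (by omega), if_pos le_rfl, if_neg (by omega), if_pos rfl]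
        linarith
      · rw [if_pos (by omega), if_pos (by omega), if_pos (by omega), if_neg (by omega),
          if_neg hne]
        exact hs
  have hLsum : ∑' i, jacobiForm a b y i ^ 2
      = (a (m - 1) * x m) ^ 2 + (a (m - 1) * x (m - 1)) ^ 2 := by
    rw [tsum_eq_sum (s := {m - 1, m}) fun i hi => ?_, Finset.sum_pair (by omega)]
    · rw [hL, hL, if_pos rfl, if_neg (by omega), if_pos rfl, neg_sq]
    · simp only [Finset.mem_insert, Finset.mem_singleton, not_or] at hi
      rw [hL, if_neg hi.1, if_neg hi.2]
      norm_num
  have ha2 : a (m - 1) ^ 2 ≤ A ^ 2 := sq_le_sq' (abs_le.1 (hA _)).1 (abs_le.1 (hA _)).2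
  rw [htsum]
  refine (h.bound y hsum).trans ?_
  rw [hLsum, mul_assoc]
  gcongr
  nlinarith [mul_le_mul_of_nonneg_right ha2 (sq_nonneg (x m)),
    mul_le_mul_of_nonneg_right ha2 (sq_nonneg (x (m - 1)))]

/-- With `T m` the tail sum, `W m = T m - T (m + 1)`; the hypothesis `T m ≤ K * W m` then reads `T
(m + 1) ≤ (1 - 1 / K) * T m`. -/
theorem exp_decay_of_tail_le {W : ℤ → ℝ} {K : ℝ} (hW : ∀ i, 0 ≤ W i) (hK : 1 < K)
    (hs : ∀ m : ℤ, Summable fun n : ℕ => W (m + n))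
    (hT : ∀ m : ℤ, ∑' n : ℕ, W (m + n) ≤ K * W m) (m : ℤ) (n : ℕ) :
    W (m + n) ≤ K * (1 - 1 / K) ^ n * W m := by
  have hK0 : 0 < K := by linarith
  have hρ : 0 ≤ 1 - 1 / K := by
    have : 1 / K ≤ 1 := by rw [div_le_one hK0]; exact hK.le
    linarith
  have hsplit : ∀ m : ℤ, ∑' n : ℕ, W (m + n) = W m + ∑' n : ℕ, W (m + 1 + n) := fun m => by
    rw [(hs m).tsum_eq_zero_add]
    simp [add_assoc, add_comm (1 : ℤ)]
  have hstep : ∀ m : ℤ, ∑' n : ℕ, W (m + 1 + n) ≤ (1 - 1 / K) * ∑' n : ℕ, W (m + n) := fun m => by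
    have h1 : 1 / K * ∑' n : ℕ, W (m + n) ≤ W m := by
      rw [one_div, inv_mul_le_iff₀ hK0]; exact hT m
    have h2 := hsplit m
    linarith
  have hiter : ∀ n : ℕ, ∑' k : ℕ, W (m + n + k) ≤ (1 - 1 / K) ^ n * ∑' k : ℕ, W (m + k) := by
    intro n
    induction n with
    | zero => simp
    | succ n ih =>
      rw [Nat.cast_succ, ← add_assoc, pow_succ', mul_assoc]
      exact (hstep _).trans (mul_le_mul_of_nonneg_left ih hρ)
  calc W (m + n) ≤ ∑' k : ℕ, W (m + n + k) := by
        simpa using (hs (m + n)).le_tsum 0 fun k _ => hW _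
    _ ≤ (1 - 1 / K) ^ n * ∑' k : ℕ, W (m + k) := hiter n
    _ ≤ (1 - 1 / K) ^ n * (K * W m) := by gcongr; exact hT m
    _ = _ := by ring

/-- Solutions that are square summable at `+∞` decay exponentially, uniformly. -/
theorem HasGreen.decay {a b : ℤ → ℝ} {M A : ℝ} (h : HasGreen a b M) (hM : 0 ≤ M)
    (hA : ∀ i, |a i| ≤ A) : ∃ K > 0, ∃ ρ, 0 < ρ ∧ ρ < 1 ∧
      ∀ x : ℤ → ℝ, RightSq x → (∀ i, jacobiForm a b x i = 0) → ∀ (m : ℤ) (n : ℕ),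
        x (m + n - 1) ^ 2 + x (m + n) ^ 2 ≤ K * ρ ^ n * (x (m - 1) ^ 2 + x m ^ 2) := by
  have hMA : 0 ≤ M * A ^ 2 := by positivity
  -- The tail of the pair energies is one boundary square plus twice the tail of `x ^ 2`, whence `2
  -- * (M * A ^ 2)`; the added `2` covers the boundary square and keeps `K > 1`, so that the rate `1
  -- - 1 / K` is positive.
  set K := 2 + 2 * (M * A ^ 2) with hKdef
  have hK : 1 < K := by linarith
  have hK0 : 0 < K := by linarith
  refine ⟨K, hK0, 1 - 1 / K, ?_, ?_, fun x hx hsol m n => ?_⟩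
  · have : 1 / K < 1 := by rw [div_lt_one hK0]; exact hK
    linarith
  · have : 0 < 1 / K := by positivity
    linarith
  have hshift : ∀ m : ℤ, (Summable fun n : ℕ => x (m + n - 1) ^ 2) ∧
      ∑' n : ℕ, x (m + n - 1) ^ 2 = x (m - 1) ^ 2 + ∑' n : ℕ, x (m + n) ^ 2 := fun m => by
    have h1 : ∀ n : ℕ, x (m + n - 1) ^ 2 = x (m - 1 + n) ^ 2 := fun n => by
      rw [sub_add_eq_add_sub]
    refine ⟨(hx (m - 1)).congr fun n => (h1 n).symm, ?_⟩
    rw [tsum_congr h1, (hx (m - 1)).tsum_eq_zero_add]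
    congr 1
    · simp
    · exact tsum_congr fun n => by push_cast; ring_nf
  refine exp_decay_of_tail_le (W := fun i => x (i - 1) ^ 2 + x i ^ 2) (fun i => by positivity) hK
    (fun m => (hshift m).1.add (hx m)) (fun m => ?_) m n
  rw [(hshift m).1.tsum_add (hx m), (hshift m).2]
  have h2 := h.tsum_tail_le hM hA hx hsol m
  simp only [hKdef]
  nlinarith [sq_nonneg (x m), sq_nonneg (x (m - 1))]

/-! ### Existence of solutions square summable at one end -/

/-- One of the responses to forcings at `0` and `1` serves as `x`. If both vanished at `1` and `2`,
row `1` would give `f 0 = 0` and `g 0 ≠ 0`, and their Wronskian to the left of `0` would be the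
constant `g 0`, impossible for square summable sequences. -/
theorem HasGreen.exists_right {a b : ℤ → ℝ} {M A : ℝ} (h : HasGreen a b M)
    (hA : ∀ i, |a i| ≤ A) (ha : ∀ i, a i ≠ 0) :
    ∃ x : ℤ → ℝ, RightSq x ∧ (∀ i, 2 ≤ i → jacobiForm a b x i = 0) ∧ (x 1 ≠ 0 ∨ x 2 ≠ 0) := by
  obtain ⟨f, hf, hf'⟩ := h.solve 0
  obtain ⟨g, hg, hg'⟩ := h.solve 1
  by_cases hg0 : g 1 ≠ 0 ∨ g 2 ≠ 0
  · exact ⟨g, .of_summable hg, fun i hi => by rw [hg', if_neg (by omega)], hg0⟩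
  by_cases hf0 : f 1 ≠ 0 ∨ f 2 ≠ 0
  · exact ⟨f, .of_summable hf, fun i hi => by rw [hf', if_neg (by omega)], hf0⟩
  exfalso
  push Not at hg0 hf0
  have eg1 : a 0 * g 0 = 1 := by
    have := hg' 1
    simp only [jacobiForm, if_true, show (1 : ℤ) - 1 = 0 by norm_num,
      show (1 : ℤ) + 1 = 2 by norm_num, hg0.1, hg0.2] at this
    linarith
  have ef1 : f 0 = 0 := by
    have := hf' 1
    simp only [jacobiForm, show (1 : ℤ) ≠ 0 by norm_num, if_false,
      show (1 : ℤ) - 1 = 0 by norm_num, show (1 : ℤ) + 1 = 2 by norm_num, hf0.1, hf0.2] at this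
    have h2 : a 0 * f 0 = 0 := by linarith
    exact (mul_eq_zero.1 h2).resolve_left (ha 0)
  have ef0 : a (-1) * f (-1) = 1 := by
    have := hf' 0
    simp only [jacobiForm, if_true, show (0 : ℤ) - 1 = -1 by norm_num,
      show (0 : ℤ) + 1 = 1 by norm_num, hf0.1, ef1] at this
    linarith
  -- Conservation of the Wronskian at sites where neither response is forced.
  have hAf : ∀ i : ℤ, i < 0 → a (i - 1) * (f (i - 1) * g i - f i * g (i - 1))
      = a i * (f i * g (i + 1) - f (i + 1) * g i) := fun i hi => by
    have h1 := hf' i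
    have h2 := hg' i
    rw [if_neg (by omega)] at h1 h2
    unfold jacobiForm at h1 h2
    linear_combination g i * h1 - f i * h2
  have hconst : ∀ n : ℕ, a (-1 - n) * (f (-1 - n) * g (-1 - n + 1) - f (-1 - n + 1) * g (-1 - n))
      = g 0 := by
    intro n
    induction n with
    | zero =>
      simp only [Nat.cast_zero, sub_zero, show (-1 : ℤ) + 1 = 0 by norm_num, ef1]
      linear_combination g 0 * ef0
    | succ n ih =>
      have h1 := hAf (-1 - n) (by omega)
      rw [ih] at h1
      rw [← h1]
      push_cast
      simp only [show (-1 : ℤ) - (n + 1) = -1 - n - 1 by ring, sub_add_cancel]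
  have hg0' : g 0 ≠ 0 := fun h0 => by simp [h0] at eg1
  have hinj : ∀ k : ℤ, Function.Injective fun n : ℕ => -1 - (n : ℤ) + k := fun k p q hpq => by
    simp only at hpq
    omega
  have hlim : ∀ x : ℤ → ℝ, (Summable fun i => x i ^ 2) → ∀ k : ℤ,
      Filter.Tendsto (fun n : ℕ => x (-1 - n + k) ^ 2) Filter.atTop (nhds 0) := fun x hx k =>
    (hx.comp_injective (hinj k)).tendsto_atTop_zero
  have hlim' := (((hlim f hf 0).add (hlim f hf 1)).add ((hlim g hg 0).add (hlim g hg 1))).const_mul A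
  simp only [add_zero, mul_zero] at hlim'
  -- The Wronskian is at most `A` times a sum of four squares, which tends to `0` at `-∞`.
  refine absurd (ge_of_tendsto' hlim' fun n => ?_) (not_le.2 (abs_pos.2 hg0'))
  rw [← hconst n, abs_mul]
  refine mul_le_mul (hA _) ?_ (abs_nonneg _) ((abs_nonneg _).trans (hA 0))
  rw [abs_le]
  constructor
  · nlinarith [sq_nonneg (f (-1 - n) + g (-1 - n + 1)), sq_nonneg (f (-1 - n + 1) - g (-1 - n)),
      sq_nonneg (f (-1 - n)), sq_nonneg (g (-1 - n)), sq_nonneg (f (-1 - n + 1)),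
      sq_nonneg (g (-1 - n + 1))]
  · nlinarith [sq_nonneg (f (-1 - n) - g (-1 - n + 1)), sq_nonneg (f (-1 - n + 1) + g (-1 - n)),
      sq_nonneg (f (-1 - n)), sq_nonneg (g (-1 - n)), sq_nonneg (f (-1 - n + 1)),
      sq_nonneg (g (-1 - n + 1))]

/-- Square summability at `-∞`. -/
def LeftSq (x : ℤ → ℝ) : Prop := RightSq fun i => x (-i)

theorem HasGreen.decay_left {a b : ℤ → ℝ} {M A : ℝ} (h : HasGreen a b M) (hM : 0 ≤ M)
    (hA : ∀ i, |a i| ≤ A) : ∃ K > 0, ∃ ρ, 0 < ρ ∧ ρ < 1 ∧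
      ∀ x : ℤ → ℝ, LeftSq x → (∀ i, jacobiForm a b x i = 0) → ∀ (m : ℤ) (n : ℕ),
        x (m - n - 1) ^ 2 + x (m - n) ^ 2 ≤ K * ρ ^ n * (x (m - 1) ^ 2 + x m ^ 2) := by
  obtain ⟨K, hK, ρ, hρ, hρ', hdec⟩ := h.reflect.decay hM fun i => hA _
  refine ⟨K, hK, ρ, hρ, hρ', fun x hx hsol m n => ?_⟩
  -- Reflection maps the pair `m - 1, m` to `1 - m, -m`, whose right member is `1 - m`.
  have h1 := hdec (fun i => x (-i)) hx (fun i => by rw [jacobiForm_reflect, hsol]) (1 - m) n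
  simp only [show -(1 - m + (n : ℤ) - 1) = m - n by ring,
    show -(1 - m + (n : ℤ)) = m - n - 1 by ring, show -(1 - m - 1) = m by ring,
    show -(1 - m) = m - 1 by ring] at h1
  linarith

theorem HasGreen.exists_left {a b : ℤ → ℝ} {M A : ℝ} (h : HasGreen a b M)
    (hA : ∀ i, |a i| ≤ A) (ha : ∀ i, a i ≠ 0) :
    ∃ x : ℤ → ℝ, LeftSq x ∧ (∀ i, i ≤ -2 → jacobiForm a b x i = 0) ∧ (x (-1) ≠ 0 ∨ x (-2) ≠ 0) := by
  obtain ⟨x, hx, hx', h0⟩ := h.reflect.exists_right (fun i => hA _) fun i => ha _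
  refine ⟨fun i => x (-i), by simpa [LeftSq] using hx, fun i hi => ?_, by simpa using h0⟩
  rw [← neg_neg i, ← jacobiForm_reflect]
  simpa using hx' (-i) (by omega)

/-- Two solutions on a right half-line with the same initial values agree. -/
theorem eq_of_jacobiForm_right {a b x y : ℤ → ℝ} {k : ℤ} (ha : ∀ i, a i ≠ 0)
    (hx : ∀ i, k < i → jacobiForm a b x i = 0) (hy : ∀ i, k < i → jacobiForm a b y i = 0)
    (h0 : x k = y k) (h1 : x (k + 1) = y (k + 1)) (n : ℕ) : x (k + n) = y (k + n) := by
  suffices h : x (k + n) = y (k + n) ∧ x (k + n + 1) = y (k + n + 1) from h.1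
  induction n with
  | zero => simpa using ⟨h0, h1⟩
  | succ n ih =>
    have ex := hx (k + n + 1) (by omega)
    have ey := hy (k + n + 1) (by omega)
    unfold jacobiForm at ex ey
    rw [add_sub_cancel_right] at ex ey
    rw [Nat.cast_succ, ← add_assoc]
    refine ⟨ih.2, mul_left_cancel₀ (ha (k + n + 1)) ?_⟩
    rw [ih.1, ih.2] at ex
    linarith

theorem eq_of_jacobiForm_left {a b x y : ℤ → ℝ} {k : ℤ} (ha : ∀ i, a i ≠ 0)
    (hx : ∀ i, i < k → jacobiForm a b x i = 0) (hy : ∀ i, i < k → jacobiForm a b y i = 0)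
    (h0 : x k = y k) (h1 : x (k - 1) = y (k - 1)) (n : ℕ) : x (k - n) = y (k - n) := by
  have h := eq_of_jacobiForm_right (a := fun j => a (-j - 1)) (b := fun j => b (-j))
    (x := fun j => x (-j)) (y := fun j => y (-j)) (k := -k) (fun i => ha _)
    (fun i hi => by rw [jacobiForm_reflect]; exact hx _ (by omega))
    (fun i hi => by rw [jacobiForm_reflect]; exact hy _ (by omega))
    (by simpa using h0) (by simpa [sub_eq_add_neg, add_comm] using h1) n
  simpa [sub_eq_add_neg, add_comm] using h

/-! ### Square summable sequences and resolvents -/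

theorem Ell2.hasSum_norm_sq {ι : Type} (X : Ell2 ι) : HasSum (fun i => ‖X i‖ ^ 2) (‖X‖ ^ 2) := by
  have h := lp.hasSum_norm (p := 2) (by norm_num) X
  simpa using h

theorem exists_ell2 {ι : Type} {x : ι → ℂ} (hx : Summable fun i => ‖x i‖ ^ 2) :
    ∃ X : Ell2 ι, ∀ i, X i = x i :=
  ⟨⟨x, memℓp_gen (by simpa using hx)⟩, fun _ => rfl⟩

theorem exists_inverse_of_not_mem_spectrum {E : Type} [NormedAddCommGroup E] [NormedSpace ℂ E]
    {T : E →L[ℂ] E} {z : ℂ} (h : z ∉ spectrum ℂ T) :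
    ∃ R : E →L[ℂ] E, (∀ x, R (z • x - T x) = x) ∧ ∀ x, z • R x - T (R x) = x := by
  rw [spectrum.notMem_iff] at h
  obtain ⟨U, hU⟩ := h
  have hT : ∀ x, (U : E →L[ℂ] E) x = z • x - T x := fun x => by
    rw [hU, sub_apply, Algebra.algebraMap_eq_smul_one]
    rfl
  refine ⟨(U⁻¹ : (E →L[ℂ] E)ˣ), fun x => ?_, fun x => ?_⟩
  · rw [← hT, ← mul_apply_eq_comp, Units.inv_mul, one_apply_eq_self]
  · rw [← hT, ← mul_apply_eq_comp, Units.mul_inv, one_apply_eq_self]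

/-- Boundedness of the resolvent `R` gives the lower bound with `M = ‖R‖ ^ 2`. Since `a`, `b` and
`λ` are real, the real part of a complex response is again a response. -/
theorem hasGreen_of_not_mem_spectrum {a b : ℤ → ℝ} {ha : ∃ K, ∀ i, |a i| ≤ K}
    {hb : ∃ K, ∀ i, |b i| ≤ K} {lam : ℝ} (h : (lam : ℂ) ∉ spectrum ℂ (jacobi a b ha hb)) :
    ∃ M, 0 ≤ M ∧ HasGreen a (fun i => b i - lam) M := by
  obtain ⟨R, hR₁, hR₂⟩ := exists_inverse_of_not_mem_spectrum h
  refine ⟨‖R‖ ^ 2, sq_nonneg _, fun x hx => ?_, fun k => ?_⟩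
  · obtain ⟨X, hX⟩ := exists_ell2 (x := fun i => (x i : ℂ)) (by simpa using hx)
    have h1 : ‖X‖ ^ 2 = ∑' i, x i ^ 2 := by
      rw [← (Ell2.hasSum_norm_sq X).tsum_eq]
      simp [hX]
    set Y := (lam : ℂ) • X - jacobi a b ha hb X with hY
    have hYi : ∀ i, Y i = -(jacobiForm a (fun i => b i - lam) x i : ℝ) := fun i => by
      change (lam : ℂ) * X i - jacobi a b ha hb X i = _
      rw [jacobi_apply]
      simp only [hX, jacobiForm]
      push_cast
      ring
    have h2 : ‖Y‖ ^ 2 = ∑' i, jacobiForm a (fun i => b i - lam) x i ^ 2 := by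
      rw [← (Ell2.hasSum_norm_sq Y).tsum_eq]
      simp [hYi]
    rw [← h1, ← h2, ← mul_pow]
    gcongr
    calc ‖X‖ = ‖R Y‖ := by rw [hY, hR₁]
      _ ≤ _ := R.le_opNorm Y
  -- The forcing is `-1` because `R` inverts `λ - J`, while `jacobiForm` represents `J - λ`.
  · obtain ⟨F, hF⟩ := exists_ell2 (x := fun i : ℤ => if i = k then (-1 : ℂ) else 0)
      (summable_of_ne_finset_zero (s := {k}) fun i hi => by
        rw [if_neg (by simpa using hi)]; simp)
    refine ⟨fun i => (R F i).re, ?_, fun i => ?_⟩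
    · refine Summable.of_nonneg_of_le (fun i => sq_nonneg _) (fun i => ?_)
        (Ell2.hasSum_norm_sq (R F)).summable
      rw [← sq_abs]
      gcongr
      exact Complex.abs_re_le_norm _
    · have h1 : (lam : ℂ) * R F i - jacobi a b ha hb (R F) i = F i := by
        conv_rhs => rw [← hR₂ F]
        rfl
      rw [jacobi_apply, hF] at h1
      have h2 := congrArg Complex.re h1
      simp only [Complex.sub_re, Complex.add_re, Complex.re_ofReal_mul] at h2
      have h3 : (if i = k then (-1 : ℂ) else 0).re = -(if i = k then 1 else 0) := by
        split_ifs <;> simp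
      rw [h3] at h2
      simp only [jacobiForm]
      linarith

/-! ### Orbits of the resonator cocycle as solutions of the Jacobi equation -/

/-- The weight `v / √ℓ` of a resonator. -/
noncomputable def Resonator.weight (r : Resonator) : ℝ := r.speed / √r.length

theorem Resonator.weight_pos (r : Resonator) : 0 < r.weight :=
  div_pos r.speed_pos (Real.sqrt_pos.2 r.length_pos)

theorem Resonator.weight_sq (r : Resonator) : r.weight ^ 2 = r.speed ^ 2 / r.length := by
  rw [weight, div_pow, Real.sq_sqrt r.length_pos.le]

theorem offDiag_eq (r r' : Resonator) : offDiag r r' = -(r.weight * r'.weight / r.spacing) := by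
  have h1 := r.length_pos
  have h2 := r'.length_pos
  have h3 := r.spacing_pos
  rw [offDiag, Resonator.weight, Resonator.weight, Real.sqrt_mul h1.le]
  field_simp

theorem diag_eq (r' r : Resonator) :
    diag r' r = r.weight ^ 2 * (1 / r'.spacing + 1 / r.spacing) := by
  rw [diag, Resonator.weight_sq]

theorem diagEdge_eq (r : Resonator) : diagEdge r = r.weight ^ 2 * (1 / r.spacing) := by
  rw [diagEdge, Resonator.weight_sq]

theorem act_coord (A : SL2R) (x : Plane) (k : Fin 2) :
    act A x k = (A : Matrix (Fin 2) (Fin 2) ℝ) k 0 * x 0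
      + (A : Matrix (Fin 2) (Fin 2) ℝ) k 1 * x 1 := by
  rw [act_apply]
  simp [Matrix.mulVec, dotProduct, Fin.sum_univ_two]

/-- Together with `act_propMat_one` this factors the propagation: the resonator first changes the
exterior derivative, then the gap transports the value linearly with the new derivative. -/
theorem act_propMat_zero (lam : ℝ) (r : Resonator) (x : Plane) :
    act (propMat lam r) x 0 = x 0 + r.spacing * act (propMat lam r) x 1 := by
  rw [act_coord, act_coord]
  simp only [propMat, Matrix.of_apply, Matrix.cons_val_zero, Matrix.cons_val_one,
    Matrix.cons_val_fin_one]
  ring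

theorem act_propMat_one (lam : ℝ) (r : Resonator) (x : Plane) :
    act (propMat lam r) x 1 = x 1 - lam / r.weight ^ 2 * x 0 := by
  rw [Resonator.weight_sq, act_coord]
  simp only [propMat, Matrix.of_apply, Matrix.cons_val_zero, Matrix.cons_val_one,
    Matrix.cons_val_fin_one]
  rw [div_div_eq_mul_div]
  ring

section Field

variable {D : ℕ} {B : Fin D → Block} {χ : ℤ → Fin D} {lam : ℝ}

/-- The sequence `v⁽ⁱ⁾` belonging to the sequence of states `w`. -/
noncomputable def fieldSeq (B : Fin D → Block) (χ : ℤ → Fin D) (w : ℤ → Plane) (i : ℤ) : ℝ :=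
  w i 0 / (labelSeq B χ i).res.weight

theorem apply_zero_eq (w : ℤ → Plane) (i : ℤ) :
    w i 0 = (labelSeq B χ i).res.weight * fieldSeq B χ w i :=
  (mul_div_cancel₀ _ (Resonator.weight_pos _).ne').symm

theorem IsOrbit.succ_zero {w : ℤ → Plane} (hw : IsOrbit (resCocycle B χ lam) w) (i : ℤ) :
    w (i + 1) 0 = w i 0 + (labelSeq B χ i).res.spacing * w (i + 1) 1 := by
  rw [hw i]; exact act_propMat_zero _ _ _

theorem IsOrbit.succ_one {w : ℤ → Plane} (hw : IsOrbit (resCocycle B χ lam) w) (i : ℤ) :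
    w (i + 1) 1 = w i 1 - lam / (labelSeq B χ i).res.weight ^ 2 * w i 0 := by
  rw [hw i]; exact act_propMat_one _ _ _

/-- The exterior derivative at `i` is the slope of the value across the preceding gap; this is the
second row of `Q(i)`. -/
theorem IsOrbit.apply_one_eq {w : ℤ → Plane} (hw : IsOrbit (resCocycle B χ lam) w) (i : ℤ) :
    w i 1 = ((labelSeq B χ i).res.weight * fieldSeq B χ w i
      - (labelSeq B χ (i - 1)).res.weight * fieldSeq B χ w (i - 1))
        / (labelSeq B χ (i - 1)).res.spacing := by
  have h := hw.succ_zero (i - 1)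
  have hs := (labelSeq B χ (i - 1)).res.spacing_pos
  rw [sub_add_cancel] at h
  rw [← apply_zero_eq, ← apply_zero_eq, h]
  field_simp
  ring

theorem coeffA_ne_zero (i : ℤ) : coeffA B χ i ≠ 0 := by
  rw [coeffA, offDiag_eq]
  have h1 := (labelSeq B χ i).res.weight_pos
  have h2 := (labelSeq B χ (i + 1)).res.weight_pos
  have h3 := (labelSeq B χ i).res.spacing_pos
  exact neg_ne_zero.2 (by positivity)

/-- The coupling to the left neighbour is replaced by the exterior derivative at the left end. At `i
= 0` the edge row of `J₊` therefore holds exactly when `w 0 1 = 0`. -/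
theorem IsOrbit.edge_row {w : ℤ → Plane} (hw : IsOrbit (resCocycle B χ lam) w) (i : ℤ) :
    coeffA B χ i * fieldSeq B χ w (i + 1)
      + (diagEdge (labelSeq B χ i).res - lam) * fieldSeq B χ w i
      = -((labelSeq B χ i).res.weight * w i 1) := by
  have h1 := (labelSeq B χ i).res.weight_pos
  have h3 := (labelSeq B χ i).res.spacing_pos
  have e1 := hw.succ_one i
  have e2 := hw.apply_one_eq (i + 1)
  rw [add_sub_cancel_right] at e2
  rw [apply_zero_eq (B := B) (χ := χ) w i, e2] at e1
  have e3 : w i 1 = ((labelSeq B χ (i + 1)).res.weight * fieldSeq B χ w (i + 1) -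
      (labelSeq B χ i).res.weight * fieldSeq B χ w i) / (labelSeq B χ i).res.spacing
      + lam / (labelSeq B χ i).res.weight ^ 2
        * ((labelSeq B χ i).res.weight * fieldSeq B χ w i) := by linarith
  rw [e3, coeffA, offDiag_eq, diagEdge_eq]
  field_simp
  ring

/-- Orbits of the resonator cocycle solve the Jacobi equation. -/
theorem IsOrbit.jacobiForm_eq_zero {w : ℤ → Plane} (hw : IsOrbit (resCocycle B χ lam) w) (i : ℤ) :
    jacobiForm (coeffA B χ) (fun i => coeffB B χ i - lam) (fieldSeq B χ w) i = 0 := by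
  have h := hw.edge_row i
  have h1 := (labelSeq B χ i).res.weight_pos
  have h3 := (labelSeq B χ (i - 1)).res.spacing_pos
  rw [hw.apply_one_eq i, diagEdge_eq] at h
  simp only [jacobiForm]
  rw [coeffB, diag_eq]
  have h4 : coeffA B χ (i - 1) = -((labelSeq B χ (i - 1)).res.weight * (labelSeq B χ i).res.weight
      / (labelSeq B χ (i - 1)).res.spacing) := by
    rw [coeffA, offDiag_eq, sub_add_cancel]
  have h5 : coeffA B χ i * fieldSeq B χ w (i + 1) = -((labelSeq B χ i).res.weight *
      (((labelSeq B χ i).res.weight * fieldSeq B χ w i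
      - (labelSeq B χ (i - 1)).res.weight * fieldSeq B χ w (i - 1))
        / (labelSeq B χ (i - 1)).res.spacing)) -
      ((labelSeq B χ i).res.weight ^ 2 * (1 / (labelSeq B χ i).res.spacing) - lam)
        * fieldSeq B χ w i := by linarith
  rw [h5, h4]
  field_simp
  ring

/-- The state at `k` is taken to be `Q(k) (q, p)ᵀ`. -/
theorem exists_isOrbit_field (B : Fin D → Block) (χ : ℤ → Fin D) (lam : ℝ) (k : ℤ) (p q : ℝ) :
    ∃ w, IsOrbit (resCocycle B χ lam) w ∧ fieldSeq B χ w (k - 1) = p ∧ fieldSeq B χ w k = q := by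
  obtain ⟨w, hw, hk⟩ := exists_isOrbit (resCocycle B χ lam) k
    !₂[(labelSeq B χ k).res.weight * q, ((labelSeq B χ k).res.weight * q
      - (labelSeq B χ (k - 1)).res.weight * p) / (labelSeq B χ (k - 1)).res.spacing]
  have h1 := (labelSeq B χ k).res.weight_pos
  have h2 := (labelSeq B χ (k - 1)).res.weight_pos
  have h3 := (labelSeq B χ (k - 1)).res.spacing_pos
  have hq : fieldSeq B χ w k = q := by
    rw [fieldSeq, hk]
    simp [h1.ne']
  refine ⟨w, hw, ?_, hq⟩
  have h4 := hw.apply_one_eq k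
  have h5 : w k 1 = ((labelSeq B χ k).res.weight * q
      - (labelSeq B χ (k - 1)).res.weight * p) / (labelSeq B χ (k - 1)).res.spacing := by
    rw [hk]; simp
  rw [h5, hq, div_left_inj' h3.ne', sub_right_inj] at h4
  exact (mul_left_cancel₀ h2.ne' h4).symm

theorem Plane.norm_sq (x : Plane) : ‖x‖ ^ 2 = x 0 ^ 2 + x 1 ^ 2 := by
  rw [EuclideanSpace.norm_sq_eq, Fin.sum_univ_two]
  simp

/-- `Q(i)` and its inverse are bounded uniformly in `i`, as only finitely many resonators occur. -/
theorem IsOrbit.norm_sq_comparable (B : Fin D → Block) (χ : ℤ → Fin D) (lam : ℝ) :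
    ∃ c₁ > 0, ∃ c₂ > 0, ∀ w, IsOrbit (resCocycle B χ lam) w → ∀ i,
      ‖w i‖ ^ 2 ≤ c₁ * (fieldSeq B χ w (i - 1) ^ 2 + fieldSeq B χ w i ^ 2) ∧
      fieldSeq B χ w (i - 1) ^ 2 + fieldSeq B χ w i ^ 2 ≤ c₂ * ‖w i‖ ^ 2 := by
  obtain ⟨p, hp⟩ := bounded_of_finite (fun l : Label B => l.res.weight) (labelSeq B χ)
  obtain ⟨q, hq⟩ := bounded_of_finite (fun l : Label B => l.res.spacing⁻¹) (labelSeq B χ)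
  obtain ⟨p', hp'⟩ := bounded_of_finite (fun l : Label B => l.res.weight⁻¹) (labelSeq B χ)
  obtain ⟨q', hq'⟩ := bounded_of_finite (fun l : Label B => l.res.spacing) (labelSeq B χ)
  have sqb : ∀ {y c z : ℝ}, |y| ≤ c → (y * z) ^ 2 ≤ c ^ 2 * z ^ 2 := fun {y c z} h => by
    rw [mul_pow]
    exact mul_le_mul_of_nonneg_right (sq_le_sq' (abs_le.1 h).1 (abs_le.1 h).2) (sq_nonneg z)
  -- The summands `1` only ensure positivity.
  refine ⟨p ^ 2 + 2 * q ^ 2 * p ^ 2 + 1, by positivity,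
    3 * p' ^ 2 + 2 * p' ^ 2 * q' ^ 2 + 1, by positivity, fun w hw i => ?_⟩
  have e0 := apply_zero_eq (B := B) (χ := χ) w i
  have e1 := hw.apply_one_eq i
  have h2 := (labelSeq B χ (i - 1)).res.weight_pos
  have h3 := (labelSeq B χ (i - 1)).res.spacing_pos
  have f0 : fieldSeq B χ w i = (labelSeq B χ i).res.weight⁻¹ * w i 0 := div_eq_inv_mul _ _
  have f1 : fieldSeq B χ w (i - 1) = (labelSeq B χ (i - 1)).res.weight⁻¹ *
      (w i 0 - (labelSeq B χ (i - 1)).res.spacing * w i 1) := by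
    rw [e1, ← e0]
    field_simp
    ring
  rw [div_eq_inv_mul] at e1
  rw [Plane.norm_sq]
  have two : ∀ y z : ℝ, (y - z) ^ 2 ≤ 2 * (y ^ 2 + z ^ 2) := fun y z => by
    nlinarith [sq_nonneg (y + z)]
  generalize fieldSeq B χ w i = x at *
  generalize fieldSeq B χ w (i - 1) = x' at *
  constructor
  · have b0 : w i 0 ^ 2 ≤ p ^ 2 * x ^ 2 := e0 ▸ sqb (hp i)
    have b1 : w i 1 ^ 2 ≤ q ^ 2 * (2 * (p ^ 2 * x ^ 2 + p ^ 2 * x' ^ 2)) := by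
      rw [e1]
      refine (sqb (hq (i - 1))).trans ?_
      gcongr
      exact (two _ _).trans (by gcongr; exacts [sqb (hp i), sqb (hp (i - 1))])
    nlinarith [sq_nonneg (p * x'), sq_nonneg x, sq_nonneg x']
  · have b0 : x ^ 2 ≤ p' ^ 2 * w i 0 ^ 2 := by rw [f0]; exact sqb (hp' i)
    have b1 : x' ^ 2 ≤ p' ^ 2 * (2 * (w i 0 ^ 2 + q' ^ 2 * w i 1 ^ 2)) := by
      rw [f1]
      refine (sqb (hp' (i - 1))).trans ?_
      gcongr
      exact (two _ _).trans (by gcongr; exact sqb (hq' (i - 1)))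
    nlinarith [sq_nonneg (p' * w i 1), sq_nonneg (p' * q' * w i 0), sq_nonneg (w i 0),
      sq_nonneg (w i 1)]

/-! ### Contraction along block edges and the hyperbolic splitting -/

theorem norm_le_of_sq_le {x y : Plane} {K ρ : ℝ} (hK : 0 < K) (hρ : 0 < ρ) {n m : ℕ}
    (hρ1 : ρ < 1) (hnm : n ≤ m) (h : ‖x‖ ^ 2 ≤ K * ρ ^ m * ‖y‖ ^ 2) :
    ‖x‖ ≤ √K * (((√ρ)⁻¹) ^ n)⁻¹ * ‖y‖ := by
  rw [inv_pow, inv_inv]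
  refine (pow_le_pow_iff_left₀ (norm_nonneg _) (by positivity) two_ne_zero).1 (h.trans ?_)
  rw [mul_pow, mul_pow, Real.sq_sqrt hK.le, ← pow_mul, mul_comm n, pow_mul, Real.sq_sqrt hρ.le]
  gcongr 1
  gcongr 1
  exact pow_le_pow_of_le_one hρ.le hρ1.le hnm

/-- Off the spectrum, orbits with square summable field contract exponentially. -/
theorem exists_contraction (h : (lam : ℂ) ∉ spectrum ℂ (J B χ)) :
    ∃ C > 0, ∃ η > 1, ∀ w, IsOrbit (resCocycle B χ lam) w →
      (RightSq (fieldSeq B χ w) → ∀ (j : ℤ) (n : ℕ), ‖w (blockStart B χ (j + n))‖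
        ≤ C * (η ^ n)⁻¹ * ‖w (blockStart B χ j)‖) ∧
      (LeftSq (fieldSeq B χ w) → ∀ (j : ℤ) (n : ℕ), ‖w (blockStart B χ (j - n))‖
        ≤ C * (η ^ n)⁻¹ * ‖w (blockStart B χ j)‖) := by
  obtain ⟨M, hM, hG⟩ := hasGreen_of_not_mem_spectrum h
  obtain ⟨A, hA⟩ := coeffA_bounded B χ
  obtain ⟨K₁, hK₁, ρ₁, hρ₁, hρ₁', hdec₁⟩ := hG.decay hM hA
  obtain ⟨K₂, hK₂, ρ₂, hρ₂, hρ₂', hdec₂⟩ := hG.decay_left hM hA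
  obtain ⟨c₁, hc₁, c₂, hc₂, hcomp⟩ := IsOrbit.norm_sq_comparable B χ lam
  -- A splitting needs one `C` and one `η` for both directions.
  set K := max K₁ K₂ with hK
  set ρ := max ρ₁ ρ₂ with hρ
  have hK0 : 0 < K := lt_max_of_lt_left hK₁
  have hρ0 : 0 < ρ := lt_max_of_lt_left hρ₁
  have hρ1 : ρ < 1 := max_lt hρ₁' hρ₂'
  have key : ∀ {w}, IsOrbit (resCocycle B χ lam) w → ∀ {K' ρ' : ℝ} {m m' : ℤ} {n n' : ℕ},
      0 < K' → 0 < ρ' → K' ≤ K → ρ' ≤ ρ → n ≤ n' →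
      fieldSeq B χ w (m' - 1) ^ 2 + fieldSeq B χ w m' ^ 2
        ≤ K' * ρ' ^ n' * (fieldSeq B χ w (m - 1) ^ 2 + fieldSeq B χ w m ^ 2) →
      ‖w m'‖ ≤ √(c₁ * K * c₂) * (((√ρ)⁻¹) ^ n)⁻¹ * ‖w m‖ := by
    intro w hw K' ρ' m m' n n' hK'0 hρ'0 hK' hρ' hn hle
    refine norm_le_of_sq_le (by positivity) hρ0 hρ1 hn ?_
    calc ‖w m'‖ ^ 2 ≤ c₁ * (fieldSeq B χ w (m' - 1) ^ 2 + fieldSeq B χ w m' ^ 2) := (hcomp w hw m').1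
      _ ≤ c₁ * (K' * ρ' ^ n' * (c₂ * ‖w m‖ ^ 2)) := by
        gcongr
        refine hle.trans ?_
        gcongr
        exact (hcomp w hw m).2
      _ ≤ c₁ * (K * ρ ^ n' * (c₂ * ‖w m‖ ^ 2)) := by gcongr
      _ = _ := by ring
  refine ⟨√(c₁ * K * c₂), by positivity, (√ρ)⁻¹, ?_, fun w hw => ⟨fun hx j n => ?_,
    fun hx j n => ?_⟩⟩
  · refine (one_lt_inv₀ (Real.sqrt_pos.2 hρ0)).2 ?_
    rw [Real.sqrt_lt' one_pos]
    simpa using hρ1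
  -- Blocks are nonempty, so `n` blocks span at least `n` resonators, and the decay per resonator
  -- carries over to blocks.
  · obtain ⟨n', hn'⟩ := Int.le.dest (blockStart_add_le B χ j n)
    have e : blockStart B χ (j + n) = blockStart B χ j + ((n + n' : ℕ) : ℤ) := by
      rw [← hn']; push_cast; ring
    rw [e]
    exact key hw hK₁ hρ₁ (le_max_left _ _) (le_max_left _ _) (Nat.le_add_right n n')
      (hdec₁ _ hx hw.jacobiForm_eq_zero _ _)
  · have h1 := blockStart_add_le B χ (j - n) n
    rw [sub_add_cancel] at h1
    obtain ⟨n', hn'⟩ := Int.le.dest h1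
    have e : blockStart B χ (j - n) = blockStart B χ j - ((n + n' : ℕ) : ℤ) := by
      rw [← hn']; push_cast; ring
    rw [e]
    exact key hw hK₂ hρ₂ (le_max_right _ _) (le_max_right _ _) (Nat.le_add_right n n')
      (hdec₂ _ hx hw.jacobiForm_eq_zero _ _)

/-- The Green solution solves the equation only from site `2` on. The orbit through its values at
`1` and `2` continues it to a solution on all of `ℤ` with the same right tail. -/
theorem exists_orbit_rightSq (h : (lam : ℂ) ∉ spectrum ℂ (J B χ)) :
    ∃ w, IsOrbit (resCocycle B χ lam) w ∧ RightSq (fieldSeq B χ w) ∧ ∀ i, w i ≠ 0 := by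
  obtain ⟨M, hM, hG⟩ := hasGreen_of_not_mem_spectrum h
  obtain ⟨A, hA⟩ := coeffA_bounded B χ
  obtain ⟨x, hx, hx', h0⟩ := hG.exists_right hA coeffA_ne_zero
  obtain ⟨w, hw, h1, h2⟩ := exists_isOrbit_field B χ lam 2 (x 1) (x 2)
  have heq := eq_of_jacobiForm_right (k := 1) coeffA_ne_zero (fun i _ => hw.jacobiForm_eq_zero i)
    (fun i hi => hx' i (by omega)) h1 h2
  refine ⟨w, hw, rightSq_of_summable (m := 1) ((hx 1).congr fun n => by rw [heq]), ?_⟩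
  refine hw.ne_zero (k := 2) fun h0' => ?_
  have e0 : fieldSeq B χ w 2 = 0 := by rw [fieldSeq, h0']; simp
  have e1 := hw.succ_zero 1
  rw [show (1 : ℤ) + 1 = 2 by norm_num, h0'] at e1
  have e2 : fieldSeq B χ w 1 = 0 := by
    rw [fieldSeq]
    have : w 1 0 = 0 := by simpa using e1.symm
    rw [this, zero_div]
  rcases h0 with h | h
  · exact h (by rw [← h1]; exact e2)
  · exact h (by rw [← h2]; exact e0)

theorem exists_orbit_leftSq (h : (lam : ℂ) ∉ spectrum ℂ (J B χ)) :
    ∃ w, IsOrbit (resCocycle B χ lam) w ∧ LeftSq (fieldSeq B χ w) ∧ ∀ i, w i ≠ 0 := by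
  obtain ⟨M, hM, hG⟩ := hasGreen_of_not_mem_spectrum h
  obtain ⟨A, hA⟩ := coeffA_bounded B χ
  obtain ⟨x, hx, hx', h0⟩ := hG.exists_left hA coeffA_ne_zero
  obtain ⟨w, hw, h1, h2⟩ := exists_isOrbit_field B χ lam (-1) (x (-2)) (x (-1))
  have heq := eq_of_jacobiForm_left (k := -1) coeffA_ne_zero (fun i _ => hw.jacobiForm_eq_zero i)
    (fun i hi => hx' i (by omega)) h2 h1
  refine ⟨w, hw, rightSq_of_summable (m := 1) ((hx 1).congr fun n => ?_), ?_⟩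
  · have := heq n
    rw [show (-1 : ℤ) - n = -(1 + n) by ring] at this
    rw [this]
  refine hw.ne_zero (k := -1) fun h0' => ?_
  have e0 : fieldSeq B χ w (-1) = 0 := by rw [fieldSeq, h0']; simp
  have e1 := hw.succ_zero (-2)
  rw [show (-2 : ℤ) + 1 = -1 by norm_num, h0'] at e1
  have e2 : fieldSeq B χ w (-2) = 0 := by
    rw [fieldSeq]
    have : w (-2) 0 = 0 := by simpa using e1.symm
    rw [this, zero_div]
  rcases h0 with h | h
  · exact h (by rw [← h2]; exact e0)
  · exact h (by rw [← h1]; exact e2)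

/-- Off the spectrum, the block cocycle has a hyperbolic splitting whose stable direction is
spanned by an orbit with square summable field. -/
theorem exists_splitting (h : (lam : ℂ) ∉ spectrum ℂ (J B χ)) :
    ∃ w, IsOrbit (resCocycle B χ lam) w ∧ RightSq (fieldSeq B χ w) ∧ (∀ i, w i ≠ 0) ∧
      ∃ s u, IsHyperbolicSplitting (blockCocycle B χ lam) s u ∧
        (s 0).submodule = Submodule.span ℝ {w 0} := by
  obtain ⟨ws, hs, hsr, hs0⟩ := exists_orbit_rightSq h
  obtain ⟨wu, hu, hul, hu0⟩ := exists_orbit_leftSq h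
  obtain ⟨C, hC, η, hη, hcon⟩ := exists_contraction h
  refine ⟨ws, hs, hsr, hs0, _, _, hs.blockStart.isHyperbolicSplitting hu.blockStart
    (fun _ => hs0 _) (fun _ => hu0 _) hC hη ((hcon ws hs).1 hsr) ((hcon wu hu).2 hul), ?_⟩
  rw [Projectivization.submodule_mk, blockStart_zero]

theorem uniformlyHyperbolic_of_not_mem_spectrum (h : (lam : ℂ) ∉ spectrum ℂ (J B χ)) :
    UniformlyHyperbolic (blockCocycle B χ lam) := by
  obtain ⟨w, -, -, -, s, u, hsu, -⟩ := exists_splitting h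
  refine ⟨?_, s, u, hsu⟩
  obtain ⟨K, hK⟩ := bounded_of_finite
    (fun p : Fin D × Fin 2 × Fin 2 =>
      (blockPropMat lam (B p.1) : Matrix (Fin 2) (Fin 2) ℝ) p.2.1 p.2.2)
    (fun p : ℤ × Fin 2 × Fin 2 => (χ p.1, p.2))
  exact ⟨K, fun i k l => hK (i, k, l)⟩

end Field

/-! ### The semi-infinite operator -/

section Half

variable {D : ℕ} {B : Fin D → Block} {χp : ℕ → Fin D} {χ' : ℤ → Fin D} {lam : ℝ}

/-- The orbit of `(1, 0)` under the resonator cocycle. -/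
noncomputable def edgeOrbit (B : Fin D → Block) (χ : ℤ → Fin D) (lam : ℝ) (i : ℤ) : Plane :=
  act (cocycleIter (resCocycle B χ lam) i 0) !₂[1, 0]

theorem edgeOrbit_isOrbit (χ : ℤ → Fin D) :
    IsOrbit (resCocycle B χ lam) (edgeOrbit B χ lam) := fun i => by
  simp only [edgeOrbit, cocycleIter_succ_zero, act_mul]

theorem edgeOrbit_zero (χ : ℤ → Fin D) : edgeOrbit B χ lam 0 = !₂[1, 0] := act_one _

theorem conjMat_inv_mulVec (r' r : Resonator) (p q : ℝ) :
    (conjMat r' r)⁻¹.mulVec ![r.weight * p, (r.weight * p - r'.weight * q) / r'.spacing]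
      = ![p, q] := by
  have h1 := r.weight_pos
  have h2 := r'.weight_pos
  have h3 := r'.spacing_pos
  have e : conjMat r' r = !![r.weight, 0; r.weight / r'.spacing, -(r'.weight / r'.spacing)] := by
    simp only [conjMat, Resonator.weight, div_div]
  have hdet : (conjMat r' r).det = -(r.weight * r'.weight / r'.spacing) := by
    rw [e, Matrix.det_fin_two_of]
    ring
  have hu : IsUnit (conjMat r' r).det := by
    rw [hdet, isUnit_iff_ne_zero, neg_ne_zero]
    positivity
  have hv : ![r.weight * p, (r.weight * p - r'.weight * q) / r'.spacing]
      = (conjMat r' r).mulVec ![p, q] := by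
    rw [e]
    ext k
    fin_cases k
    · simp [Matrix.mulVec, dotProduct, Fin.sum_univ_two]
    · simp [Matrix.mulVec, dotProduct, Fin.sum_univ_two]
      ring
  rw [hv, Matrix.mulVec_mulVec, Matrix.nonsing_inv_mul _ hu, Matrix.one_mulVec]

/-- Applying `Q(i)⁻¹` undoes the passage from field values to states, so the stated eigenvector is
the field of the edge orbit. -/
theorem edgeVec_eq (χ : ℤ → Fin D) (i : ℤ) :
    edgeVec B χ lam i = ![fieldSeq B χ (edgeOrbit B χ lam) i,
      fieldSeq B χ (edgeOrbit B χ lam) (i - 1)] := by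
  rw [← conjMat_inv_mulVec (labelSeq B χ (i - 1)).res (labelSeq B χ i).res,
    ← apply_zero_eq, edgeVec, conjSeq, ← Matrix.mulVec_mulVec]
  congr 1
  rw [apply_zero_eq (B := B) (χ := χ), ← (edgeOrbit_isOrbit χ).apply_one_eq,
    ← apply_zero_eq (B := B) (χ := χ)]
  ext k
  fin_cases k <;> rfl

theorem JPlus_apply_zero (hext : Extends χp χ') (X : Ell2 ℕ) :
    JPlus B χp X 0 = coeffA B χ' 0 * X 1 + diagEdge (labelSeq B χ' 0).res * X 0 := by
  rw [JPlus, jacobiHalf_apply_zero]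
  simp only [coeffAHalf, coeffBHalf, labelSeqHalf_eq hext, coeffA]
  rfl

theorem JPlus_apply_succ (hext : Extends χp χ') (X : Ell2 ℕ) (n : ℕ) :
    JPlus B χp X (n + 1) = coeffA B χ' n * X n + coeffA B χ' (n + 1) * X (n + 2)
      + coeffB B χ' (n + 1) * X (n + 1) := by
  rw [JPlus, jacobiHalf_apply_succ]
  simp only [coeffAHalf, coeffBHalf, labelSeqHalf_eq hext, coeffA, coeffB, Nat.cast_add,
    Nat.cast_one, add_sub_cancel_right]

theorem coeffA_complex_ne_zero (χ : ℤ → Fin D) (i : ℤ) : (coeffA B χ i : ℂ) ≠ 0 :=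
  Complex.ofReal_ne_zero.2 (coeffA_ne_zero i)

/-- Serves twice: for the edge orbit the defect at `0` vanishes and an eigenvector results; for a
decaying orbit with `w 0 1 ≠ 0` it is the tool for correcting row `0`. -/
theorem IsOrbit.JPlus_sub {w : ℤ → Plane} (hw : IsOrbit (resCocycle B χ' lam) w)
    (hext : Extends χp χ') {X : Ell2 ℕ} (hX : ∀ n : ℕ, X n = (fieldSeq B χ' w n : ℂ)) (n : ℕ) :
    (lam : ℂ) * X n - JPlus B χp X n
      = if n = 0 then (((labelSeq B χ' 0).res.weight * w 0 1 : ℝ) : ℂ) else 0 := by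
  cases n with
  | zero =>
    rw [if_pos rfl, JPlus_apply_zero hext, hX, hX]
    have h := congrArg (fun t : ℝ => (t : ℂ)) (hw.edge_row 0)
    push_cast at h ⊢
    linear_combination -h
  | succ n =>
    rw [if_neg (Nat.succ_ne_zero n), JPlus_apply_succ hext, hX, hX, hX]
    have h := congrArg (fun t : ℝ => (t : ℂ)) (hw.jacobiForm_eq_zero (n + 1))
    simp only [jacobiForm, add_sub_cancel_right] at h
    rw [show (n : ℤ) + 1 + 1 = n + 2 by ring] at h
    push_cast at h ⊢
    linear_combination -h

/-- Solutions of the half-line eigenvalue equation are multiples of the edge solution. -/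
theorem eigenvector_eq (hext : Extends χp χ') {X : Ell2 ℕ}
    (hX : JPlus B χp X = (lam : ℂ) • X) (n : ℕ) :
    X n = X 0 * (labelSeq B χ' 0).res.weight
      * (fieldSeq B χ' (edgeOrbit B χ' lam) n : ℂ) := by
  have hrow : ∀ n, JPlus B χp X n = lam * X n := fun n => by rw [hX]; rfl
  have hw := edgeOrbit_isOrbit (B := B) (lam := lam) χ'
  set c := X 0 * ((labelSeq B χ' 0).res.weight : ℂ) with hc
  have hw0 : ((labelSeq B χ' 0).res.weight : ℂ) ≠ 0 :=
    Complex.ofReal_ne_zero.2 (Resonator.weight_pos _).ne'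
  have h0 : X 0 = c * (fieldSeq B χ' (edgeOrbit B χ' lam) 0 : ℂ) := by
    rw [fieldSeq, edgeOrbit_zero, hc]
    simp [hw0]
  suffices h : X n = c * (fieldSeq B χ' (edgeOrbit B χ' lam) n : ℂ) ∧
      X (n + 1) = c * (fieldSeq B χ' (edgeOrbit B χ' lam) (n + 1) : ℂ) from h.1
  induction n with
  | zero =>
    refine ⟨h0, mul_left_cancel₀ (coeffA_complex_ne_zero (B := B) χ' 0) ?_⟩
    have h1 := hrow 0
    rw [JPlus_apply_zero hext] at h1
    have h2 := congrArg (fun t : ℝ => (t : ℂ)) (hw.edge_row 0)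
    -- The vanishing derivative makes the edge orbit satisfy row `0`, which determines the value at
    -- `1` from the value at `0`.
    have h3 : edgeOrbit B χ' lam 0 1 = 0 := by rw [edgeOrbit_zero]; simp
    rw [h3] at h2
    push_cast at h2 ⊢
    linear_combination h1 - c * h2 + (lam - diagEdge (labelSeq B χ' 0).res : ℂ) * h0
  | succ n ih =>
    refine ⟨by rw [ih.2]; push_cast; rfl,
      mul_left_cancel₀ (coeffA_complex_ne_zero (B := B) χ' (n + 1)) ?_⟩
    have h1 := hrow (n + 1)
    rw [JPlus_apply_succ hext] at h1
    have h := congrArg (fun t : ℝ => (t : ℂ)) (hw.jacobiForm_eq_zero (n + 1))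
    simp only [jacobiForm, add_sub_cancel_right] at h
    rw [show (n : ℤ) + 1 + 1 = n + 2 by ring] at h
    push_cast at h ⊢
    rw [show (n : ℤ) + 1 + 1 = n + 2 by ring]
    linear_combination h1 - c * h - coeffA B χ' n * ih.1
      + (lam - coeffB B χ' (n + 1) : ℂ) * ih.2

theorem exists_ell2_field {w : ℤ → Plane} (h : RightSq (fieldSeq B χ' w)) :
    ∃ X : Ell2 ℕ, ∀ n : ℕ, X n = (fieldSeq B χ' w n : ℂ) :=
  exists_ell2 ((h 0).congr fun n => by simp)

theorem rightSq_of_eigenvector (hext : Extends χp χ') {X : Ell2 ℕ}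
    (hX : JPlus B χp X = (lam : ℂ) • X) (hX0 : X ≠ 0) :
    RightSq (fieldSeq B χ' (edgeOrbit B χ' lam)) := by
  have heq := eigenvector_eq hext hX
  generalize X 0 * ((labelSeq B χ' 0).res.weight : ℂ) = c at heq
  have hc : c ≠ 0 := fun hc => hX0 (by ext n; rw [heq n, hc]; simp)
  refine rightSq_of_summable (m := 0)
    (((Ell2.hasSum_norm_sq X).summable.mul_left ((‖c‖ ^ 2)⁻¹)).congr fun n => ?_)
  rw [heq n, norm_mul, mul_pow, inv_mul_cancel_left₀ (by positivity)]
  simp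

theorem isSimpleEdgeEigenvalue_of_rightSq (hext : Extends χp χ')
    (h : RightSq (fieldSeq B χ' (edgeOrbit B χ' lam))) :
    (lam : ℂ) ∈ spectrum ℂ (JPlus B χp) ∧ IsSimpleEdgeEigenvalue B χp χ' lam := by
  obtain ⟨V, hV⟩ := exists_ell2_field h
  have hrow := (edgeOrbit_isOrbit (B := B) (lam := lam) χ').JPlus_sub hext hV
  have hVeq : JPlus B χp V = (lam : ℂ) • V := by
    ext n
    have := hrow n
    rw [edgeOrbit_zero] at this
    simp only [Matrix.cons_val_one, Matrix.cons_val_fin_one, mul_zero,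
      Complex.ofReal_zero, ite_self] at this
    exact (sub_eq_zero.1 this).symm
  have hV0 : V ≠ 0 := fun h0 => by
    have h1 := hV 0
    rw [h0, Nat.cast_zero, fieldSeq, edgeOrbit_zero] at h1
    have h2 := (labelSeq B χ' 0).res.weight_pos
    simp at h1
    exact h2.ne (by exact_mod_cast h1)
  have hVeig : Module.End.HasEigenvector (JPlus B χp : Ell2 ℕ →ₗ[ℂ] Ell2 ℕ) (lam : ℂ) V :=
    ⟨Module.End.mem_eigenspace_iff.2 hVeq, hV0⟩
  refine ⟨fun hu => ?_, ?_, V, fun i => ?_, fun i => ?_, hVeig⟩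
  · obtain ⟨R, hR, -⟩ := exists_inverse_of_not_mem_spectrum
      (z := (lam : ℂ)) (T := JPlus B χp) (fun hn => hn hu)
    have := hR V
    rw [hVeq, sub_self, map_zero] at this
    exact hV0 this.symm
  · refine (finrank_eq_one_iff_of_nonzero'
      (⟨V, hVeig.1⟩ : Module.End.eigenspace (JPlus B χp : Ell2 ℕ →ₗ[ℂ] Ell2 ℕ) (lam : ℂ))
      fun h0 => hV0 (congrArg Subtype.val h0)).2 fun X => ?_
    have hX : JPlus B χp X.1 = (lam : ℂ) • X.1 := Module.End.mem_eigenspace_iff.1 X.2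
    refine ⟨X.1 0 * ((labelSeq B χ' 0).res.weight : ℂ), Subtype.ext ?_⟩
    ext n
    rw [eigenvector_eq hext hX n, ← hV n]
    rfl
  · rw [hV, edgeVec_eq]; rfl
  · rw [hV, edgeVec_eq, add_sub_cancel_right]; rfl

/-! ### The stable direction and the half-line resolvent set -/

theorem IsOrbit.eq_of_zero {P : ℤ → SL2R} {w w' : ℤ → Plane} (hw : IsOrbit P w)
    (hw' : IsOrbit P w') (h : w 0 = w' 0) : w = w' := by
  have hd : IsOrbit P fun i => w i - w' i := fun i => by simp only [hw i, hw' i, map_sub]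
  by_contra hne
  obtain ⟨i, hi⟩ := Function.ne_iff.1 hne
  exact hd.ne_zero (k := i) (sub_ne_zero.2 hi) 0 (sub_eq_zero.2 h)

theorem rightSq_edge_of_mem_span {w : ℤ → Plane} (hw : IsOrbit (resCocycle B χ' lam) w)
    (h : RightSq (fieldSeq B χ' w)) (hm : !₂[(1 : ℝ), 0] ∈ Submodule.span ℝ {w 0}) :
    RightSq (fieldSeq B χ' (edgeOrbit B χ' lam)) := by
  obtain ⟨c, hc⟩ := Submodule.mem_span_singleton.1 hm
  have hcw : IsOrbit (resCocycle B χ' lam) fun i => c • w i := fun i => by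
    simp only [hw i, map_smul]
  rw [(edgeOrbit_isOrbit χ').eq_of_zero hcw (by rw [edgeOrbit_zero, hc])]
  intro m
  refine ((h m).mul_left (c ^ 2)).congr fun n => ?_
  simp only [fieldSeq, PiLp.smul_apply, smul_eq_mul]
  ring

/-- Off the bi-infinite spectrum, the edge solution is square summable exactly if it starts in the
stable direction. -/
theorem mem_stable_iff (h : (lam : ℂ) ∉ spectrum ℂ (J B χ')) {s u}
    (hsu : IsHyperbolicSplitting (blockCocycle B χ' lam) s u) :
    !₂[(1 : ℝ), 0] ∈ (s 0).submodule ↔ RightSq (fieldSeq B χ' (edgeOrbit B χ' lam)) := by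
  have hfw : ∀ n : ℕ, act (forwardIter (blockCocycle B χ' lam) n 0) !₂[(1 : ℝ), 0]
      = edgeOrbit B χ' lam (blockStart B χ' n) := fun n => by
    have := (edgeOrbit_isOrbit (B := B) (lam := lam) χ').blockStart.forwardIter n 0
    rwa [blockStart_zero, edgeOrbit_zero, zero_add] at this
  constructor
  · intro hm
    -- The given splitting may differ from the constructed one, but bounded forward orbits
    -- characterise the stable line of either.
    obtain ⟨w, hw, hr, -, s', u', hsu', hs'⟩ := exists_splitting h
    refine rightSq_edge_of_mem_span hw hr ?_
    rw [← hs']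
    obtain ⟨C, hC, η, hη, hg⟩ := hsu.growth
    refine hsu'.mem_stable_of_bounded (K := C * ‖!₂[(1 : ℝ), 0]‖) fun n => ?_
    refine (norm_le_of_unit_bound (hg 0 n).2 hm).trans ?_
    gcongr
    exact mul_le_of_le_one_right hC.le (inv_le_one_of_one_le₀ (one_le_pow₀ hη.le))
  · intro hr
    obtain ⟨C, hC, η, hη, hcon⟩ := exists_contraction h
    refine hsu.mem_stable_of_bounded (K := C * ‖!₂[(1 : ℝ), 0]‖) fun n => ?_
    have h1 := (hcon _ (edgeOrbit_isOrbit χ')).1 hr 0 n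
    rw [zero_add, blockStart_zero, edgeOrbit_zero, ← hfw] at h1
    refine h1.trans ?_
    gcongr
    exact mul_le_of_le_one_right hC.le (inv_le_one_of_one_le₀ (one_le_pow₀ hη.le))

/-- Extend `F` by zero, apply the full-line resolvent and restrict: `J` and `J₊` have the same rows
away from the edge. -/
theorem exists_half_solution_off_edge (hext : Extends χp χ')
    (h : (lam : ℂ) ∉ spectrum ℂ (J B χ')) (F : Ell2 ℕ) :
    ∃ X : Ell2 ℕ, ∀ n : ℕ, (lam : ℂ) * X (n + 1) - JPlus B χp X (n + 1) = F (n + 1) := by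
  obtain ⟨R, -, hR⟩ := exists_inverse_of_not_mem_spectrum h
  have hinj : Function.Injective fun n : ℕ => (n : ℤ) := fun p q hpq => by simpa using hpq
  obtain ⟨G, hG⟩ := exists_ell2 (x := fun i : ℤ => if 0 ≤ i then F i.toNat else 0) (by
    refine (hinj.summable_iff fun i hi => ?_).1
      ((Ell2.hasSum_norm_sq F).summable.congr fun n => ?_)
    · have : ¬ 0 ≤ i := fun h0 => hi ⟨i.toNat, by simpa using h0⟩
      simp [this]
    · simp)
  obtain ⟨X, hX⟩ := exists_ell2 (x := fun n : ℕ => R G n)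
    ((Ell2.hasSum_norm_sq (R G)).summable.comp_injective hinj)
  refine ⟨X, fun n => ?_⟩
  have h1 : (lam : ℂ) * R G (n + 1) - J B χ' (R G) (n + 1) = G (n + 1) := by
    conv_rhs => rw [← hR G]
    rfl
  have h2 : G ((n : ℤ) + 1) = F (n + 1) := by
    rw [hG, if_pos (by omega)]
    rfl
  rw [h2, J, jacobi_apply, add_sub_cancel_right, show (n : ℤ) + 1 + 1 = n + 2 by ring] at h1
  rw [← h1, JPlus_apply_succ hext, hX, hX, hX]
  push_cast
  rfl

/-- A kernel vector would make the edge orbit square summable. For surjectivity only row `0` remains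
to be repaired, by a multiple of the decaying orbit. -/
theorem not_mem_spectrum_JPlus (hext : Extends χp χ') (h : (lam : ℂ) ∉ spectrum ℂ (J B χ'))
    (hr : ¬ RightSq (fieldSeq B χ' (edgeOrbit B χ' lam))) :
    (lam : ℂ) ∉ spectrum ℂ (JPlus B χp) := by
  rw [spectrum.notMem_iff, ContinuousLinearMap.isUnit_iff_bijective]
  have happ : ∀ X, (algebraMap ℂ (Ell2 ℕ →L[ℂ] Ell2 ℕ) lam - JPlus B χp) X
      = (lam : ℂ) • X - JPlus B χp X := fun X => by
    rw [sub_apply, Algebra.algebraMap_eq_smul_one]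
    rfl
  constructor
  · rw [injective_iff_map_eq_zero]
    intro X hX
    rw [happ, sub_eq_zero] at hX
    by_contra h0
    exact hr (rightSq_of_eigenvector hext hX.symm h0)
  · intro F
    obtain ⟨w, hw, hwr, hw0, -⟩ := exists_splitting h
    -- Otherwise `w 0` would be a multiple of `(1, 0)`, and the edge orbit would decay with it.
    have h1 : w 0 1 ≠ 0 := fun h1 => by
      have hne : w 0 0 ≠ 0 := fun h0 => hw0 0 (by
        ext k
        fin_cases k
        · exact h0
        · exact h1)
      refine hr (rightSq_edge_of_mem_span hw hwr
        (Submodule.mem_span_singleton.2 ⟨(w 0 0)⁻¹, ?_⟩))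
      ext k
      fin_cases k
      · simp [hne]
      · simp [h1]
    set κ : ℂ := (((labelSeq B χ' 0).res.weight * w 0 1 : ℝ) : ℂ)
    have hκ : κ ≠ 0 := Complex.ofReal_ne_zero.2 (mul_ne_zero (Resonator.weight_pos _).ne' h1)
    obtain ⟨Y, hY⟩ := exists_ell2_field hwr
    obtain ⟨X, hX⟩ := exists_half_solution_off_edge hext h F
    have hYrow := hw.JPlus_sub hext hY
    -- The residual of row `0` divided by `κ`, the only nonzero entry of `(λ - J₊) Y`.
    set c := (F 0 - (lam * X 0 - JPlus B χp X 0)) / κ with hc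
    refine ⟨X + c • Y, ?_⟩
    rw [happ]
    ext n
    have hlin : ((lam : ℂ) • (X + c • Y) - JPlus B χp (X + c • Y) : Ell2 ℕ) n
        = (lam * X n - JPlus B χp X n) + c * (lam * Y n - JPlus B χp Y n) := by
      rw [map_add, map_smul]
      change (lam : ℂ) * (X n + c * Y n) - (JPlus B χp X n + c * JPlus B χp Y n) = _
      ring
    rw [hlin, hYrow]
    cases n with
    | zero => rw [if_pos rfl, hc, div_mul_cancel₀ _ hκ]; ring
    | succ n => rw [if_neg (Nat.succ_ne_zero n), hX, mul_zero, add_zero]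

end Half

end BlockDisorder

open BlockDisorder
theorem theorem4p4 {D : ℕ} (B : Fin D → Block) (χp : ℕ → Fin D) (χ' : ℤ → Fin D)
    (hχ : PseudoErgodic χp) (hext : Extends χp χ') :
    (∀ lam : ℝ, (lam : ℂ) ∈ spectrum ℂ (JPlus B χp) \ spectrum ℂ (J B χ') →
      UniformlyHyperbolic (blockCocycle B χ' lam) ∧
      (∀ s u, IsHyperbolicSplitting (blockCocycle B χ' lam) s u →
        !₂[(1 : ℝ), 0] ∈ (s 0).submodule) ∧
      IsSimpleEdgeEigenvalue B χp χ' lam) ∧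
    (∀ lam : ℝ, (lam : ℂ) ∉ spectrum ℂ (J B χ') →
      UniformlyHyperbolic (blockCocycle B χ' lam) ∧
      ∀ s u, IsHyperbolicSplitting (blockCocycle B χ' lam) s u →
        !₂[(1 : ℝ), 0] ∈ (s 0).submodule →
        (lam : ℂ) ∈ spectrum ℂ (JPlus B χp) ∧ IsSimpleEdgeEigenvalue B χp χ' lam) := by
  refine ⟨fun lam hlam => ?_, fun lam hlam =>
    ⟨uniformlyHyperbolic_of_not_mem_spectrum hlam, fun s u hsu hm =>
      isSimpleEdgeEigenvalue_of_rightSq hext ((mem_stable_iff hlam hsu).1 hm)⟩⟩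
  have hr : RightSq (fieldSeq B χ' (edgeOrbit B χ' lam)) := by
    by_contra hr
    exact not_mem_spectrum_JPlus hext hlam.2 hr hlam.1
  exact ⟨uniformlyHyperbolic_of_not_mem_spectrum hlam.2,
    fun s u hsu => (mem_stable_iff hlam.2 hsu).2 hr,
    (isSimpleEdgeEigenvalue_of_rightSq hext hr).2⟩
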